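/- Let $\Gamma\subset \mathrm{SL}_2(\mathbb R)$ be a Fuchsian group of the first kind, i.e. a discrete subgroup such that $\Gamma\backslash\mathbb H$ has finite hyperbolic volume, and let $k>2$ be an even integer. Write $j(g,z)=cz+d$ and $(f|_kg)(z)=j(g,z)^{-k}f(gz)$ for $g=\begin{pmatrix}a&b\\c&d\end{pmatrix}$, write $\mathbf e(w)=e^{2\pi i w}$, and let all complex powers be principal ($-\pi<\arg\le\pi$). Let $\eta=(\eta_1,\eta_2)$ be an ordered pair of distinct points of $\mathbb R\cup\{\infty\}$ fixed by a common hyperbolic element of $\Gamma$, let $\Gamma_\eta$ be the subgroup of $\Gamma$ fixing $\eta_1$ and $\eta_2$, and let $\sigma_\eta\in \mathrm{SL}_2(\mathbb R)$ satisfy $\sigma_\eta 0=\eta_1$, $\sigma_\eta\infty=\eta_2$. Let $\ell_\eta>0$ be the number with $\pm\sigma_\eta^{-1}\Gamma_\eta\sigma_\eta=\left\{\pm\begin{pmatrix}e^{m\ell_\eta/2}&0\\0&e^{-m\ell_\eta/2}\end{pmatrix}: m\in\mathbb Z\right\}$. Let $\mathfrak a$ be a cusp of $\Gamma$ with stabilizer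 $\Gamma_{\mathfrak a}$, and let $\sigma_{\mathfrak a}\in \mathrm{SL}_2(\mathbb R)$ satisfy $\sigma_{\mathfrak a}\infty=\mathfrak a$ and $\pm\sigma_{\mathfrak a}^{-1}\Gamma_{\mathfrak a}\sigma_{\mathfrak a}=\left\{\pm\begin{pmatrix}1&m\\0&1\end{pmatrix}: m\in\mathbb Z\right\}$. For $m\in\mathbb Z$ the hyperbolic Poincaré series is $$P_{\eta,m}(z)=\sum_{\gamma\in\Gamma_\eta\backslash\Gamma}\frac{(\sigma_\eta^{-1}\gamma z)^{-k/2+2\pi i m/\ell_\eta}}{j(\sigma_\eta^{-1}\gamma,z)^k}\qquad(z\in\mathbb H).$$ Put $C_{\eta\mathfrak a}=\left\{ac : \begin{pmatrix}a&b\\c&d\end{pmatrix}\in\sigma_\eta^{-1}\Gamma\sigma_{\mathfrak a}\right\}$ and, for $m,n\in\mathbb Z$, $C\in C_{\eta\mathfrak a}$, $r\in\mathbb R\setminus\{0\}$ and $y>0$, $$S_{\eta\mathfrak a}(m,n;C)=\sum_{\substack{\gamma\in\Gamma_\eta\backslash\Gamma/\Gamma_{\mathfrak a}\\ \left(\begin{smallmatrix}a&b\\c&d\end{smallmatrix}\right)=\sigma_\eta^{-1}\gamma\sigma_{\mathfrak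 a},\ ac=C}}\mathbf e\left(\frac m{\ell_\eta}\log\left|\frac ac\right|+n\left(\frac b{2a}+\frac d{2c}\right)\right),$$ $$I_{\eta\mathfrak a}(m,n;r)=\int_{-\infty+iy}^{\infty+iy}\frac{\left(\operatorname{sgn}(r)\frac{u-r}{u+r}\right)^{2\pi i m/\ell_\eta}e^{-2\pi i n u}}{(u-r)^{k/2}(u+r)^{k/2}}\,du .$$ **Theorem.** Let $m\in\mathbb Z$ and let $y>0$ be the height used in the integrals $I_{\eta\mathfrak a}$. The series $P_{\eta,m}(z)$ converges absolutely for every $z\in\mathbb H$; $0\notin C_{\eta\mathfrak a}$; for all $C\in C_{\eta\mathfrak a}$ and $n\in\mathbb Z$ the sum $S_{\eta\mathfrak a}(m,n;C)$ is finite and the integral $I_{\eta\mathfrak a}\left(m,n;\frac1{2C}\right)$ converges absolutely. The parabolic Fourier expansion $$(P_{\eta,m}|_k\sigma_{\mathfrak a})(z)=\sum_{n\in\mathbb Z}c_{\mathfrak a}(n;P_{\eta,m})\,e^{2\pi i n z}\qquad(z\in\mathbb H)$$ exists, its coefficients are unique, and for every $n\in\mathbb Z$ $$c_{\mathfrak a}(n;P_{\eta,m})=\sum_{C\in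 C_{\eta\mathfrak a}}C^{-k/2}\,I_{\eta\mathfrak a}\left(m,n;\frac1{2C}\right)S_{\eta\mathfrak a}(m,n;C),$$ where the sum over $C$ converges absolutely. -/

import Mathlib

open Complex MeasureTheory
open scoped MatrixGroups UpperHalfPlane

noncomputable section

namespace HypPoincare

/-- `Γ ⊂ SL₂(ℝ)` is a Fuchsian group of the first kind: it is discrete, and `Γ\ℍ` has finite
hyperbolic volume. The volume is that of a fundamental domain for the group of transformations of
`ℍ` induced by `Γ`, that is, for the image of `Γ` modulo `±I`. -/
structure IsFuchsianFirstKind (Γ : Subgroup SL(2, ℝ)) : Prop where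
  discrete : DiscreteTopology Γ
  finite_covolume : ∃ F : Set ℍ,
    IsFundamentalDomain (Γ.map (MulAction.toPermHom SL(2, ℝ) ℍ)) F volume ∧ volume F < ⊤

/-- The action of `SL₂(ℝ)` on `ℝ ∪ {∞}` by linear fractional transformations. -/
def bdry (g : SL(2, ℝ)) (x : OnePoint ℝ) : OnePoint ℝ := (g.toGL : GL (Fin 2) ℝ) • x

lemma bdry_one (x : OnePoint ℝ) : bdry 1 x = x := by simp [bdry]

lemma bdry_mul (g h : SL(2, ℝ)) (x : OnePoint ℝ) : bdry (g * h) x = bdry g (bdry h x) := by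
  simp [bdry, mul_smul]

/-- The subgroup of `Γ` fixing a point of `ℝ ∪ {∞}`. -/
def fixer (Γ : Subgroup SL(2, ℝ)) (x : OnePoint ℝ) : Subgroup Γ where
  carrier := {γ | bdry γ x = x}
  one_mem' := bdry_one x
  mul_mem' {a b} ha hb := by
    simp only [Set.mem_ofPred_eq, Subgroup.coe_mul, bdry_mul] at *
    rw [hb, ha]
  inv_mem' {a} ha := by
    simp only [Set.mem_ofPred_eq, Subgroup.coe_inv] at *
    conv_lhs => rw [← ha]
    rw [← bdry_mul, inv_mul_cancel, bdry_one]

/-- `Γ_η` for `η = (η₁, η₂)`: the elements of `Γ` fixing both `η₁` and `η₂`. -/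
def pairFixer (Γ : Subgroup SL(2, ℝ)) (η : OnePoint ℝ × OnePoint ℝ) : Subgroup Γ :=
  fixer Γ η.1 ⊓ fixer Γ η.2

/-- `η = (η₁, η₂)` is an ordered hyperbolic fixed pair for `Γ`. -/
def IsHypPair (Γ : Subgroup SL(2, ℝ)) (η : OnePoint ℝ × OnePoint ℝ) : Prop :=
  η.1 ≠ η.2 ∧ ∃ γ ∈ Γ, (γ : Matrix (Fin 2) (Fin 2) ℝ).IsHyperbolic ∧
    bdry γ η.1 = η.1 ∧ bdry γ η.2 = η.2

/-- `σ` is a scaling matrix for the pair `η`: `σ 0 = η₁` and `σ ∞ = η₂`. -/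
def IsHypScaling (η : OnePoint ℝ × OnePoint ℝ) (σ : SL(2, ℝ)) : Prop :=
  bdry σ ((0 : ℝ) : OnePoint ℝ) = η.1 ∧ bdry σ OnePoint.infty = η.2

/-- The translation matrix with rows `(1, t)` and `(0, 1)`. -/
def transMat (t : ℝ) : SL(2, ℝ) := ⟨!![1, t; 0, 1], by simp [Matrix.det_fin_two]⟩

/-- The diagonal matrix with entries `e^{t/2}`, `e^{-t/2}`. -/
def dilMat (t : ℝ) : SL(2, ℝ) :=
  ⟨!![Real.exp (t / 2), 0; 0, Real.exp (-(t / 2))], by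
    simp [Matrix.det_fin_two, ← Real.exp_add]⟩

/-- `σ` is a scaling matrix for the cusp `𝔞`: `σ ∞ = 𝔞`, and `σ⁻¹ Γ_𝔞 σ`, taken modulo `±I`,
is `{±(1, m; 0, 1) : m ∈ ℤ}`. -/
def IsCuspScaling (Γ : Subgroup SL(2, ℝ)) (𝔞 : OnePoint ℝ) (σ : SL(2, ℝ)) : Prop :=
  bdry σ OnePoint.infty = 𝔞 ∧
  ∀ g : SL(2, ℝ), (∃ γ ∈ fixer Γ 𝔞, σ⁻¹ * γ * σ = g ∨ σ⁻¹ * γ * σ = -g) ↔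
    ∃ m : ℤ, g = transMat m ∨ g = -transMat m

/-- The length `ℓ_η`: the least `ℓ > 0` such that one of `±diag(e^{ℓ/2}, e^{-ℓ/2})` lies in
`σ_η⁻¹ Γ_η σ_η`. This is the `ℓ > 0` for which `σ_η⁻¹ Γ_η σ_η`, taken modulo `±I`, is
`{±diag(e^{mℓ/2}, e^{-mℓ/2}) : m ∈ ℤ}`. -/
def hypLength (Γ : Subgroup SL(2, ℝ)) (η : OnePoint ℝ × OnePoint ℝ) (ση : SL(2, ℝ)) : ℝ :=
  sInf {l : ℝ | 0 < l ∧ ∃ γ ∈ pairFixer Γ η,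
    ση⁻¹ * γ * ση = dilMat l ∨ ση⁻¹ * γ * ση = -dilMat l}

/-- The weight `k` slash operator `f |_k g` of `g ∈ SL₂(ℝ)`, given by
`(f |_k g)(z) = (cz + d)^{-k} f(gz)`. -/
def slash (k : ℤ) (f : ℍ → ℂ) (g : SL(2, ℝ)) : ℍ → ℂ :=
  SlashAction.map k (g.toGL : GL (Fin 2) ℝ) f

lemma slash_apply (k : ℤ) (f : ℍ → ℂ) (g : SL(2, ℝ)) (z : ℍ) :
    slash k f g z = ((g 1 0 : ℂ) * z + g 1 1) ^ (-k) * f (g • z) := by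
  have h : ((g.toGL : GL (Fin 2) ℝ) • z) = g • z := by
    ext
    rw [UpperHalfPlane.coe_specialLinearGroup_apply,
      UpperHalfPlane.coe_smul_of_det_pos (by simp)]
    rfl
  rw [slash, ModularForm.slash_apply, h, mul_comm]
  simp [UpperHalfPlane.σ, UpperHalfPlane.denom]

/-- The term `(z^{-k/2 + 2πim/ℓ} |_k σ_η⁻¹γ)(z)`; complex powers are principal. -/
def poincareTerm (k : ℤ) (l : ℝ) (m : ℤ) (ση γ : SL(2, ℝ)) : ℍ → ℂ :=
  slash k (fun z => (z : ℂ) ^ (-(k : ℂ) / 2 + 2 * Real.pi * I * m / l)) (ση⁻¹ * γ)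

/-- The set `Γ_η \ Γ` of cosets `Γ_η γ`. -/
abbrev HypCosets (Γ : Subgroup SL(2, ℝ)) (η : OnePoint ℝ × OnePoint ℝ) : Type :=
  _root_.Quotient (QuotientGroup.rightRel (pairFixer Γ η))

/-- The hyperbolic Poincaré series `P_{η,m}` of weight `k`, a sum over representatives of
`Γ_η \ Γ`. For even `k` a term does not depend on the representative. -/
def hypPoincare (Γ : Subgroup SL(2, ℝ)) (k : ℤ) (η : OnePoint ℝ × OnePoint ℝ) (ση : SL(2, ℝ))
    (m : ℤ) (z : ℍ) : ℂ :=
  ∑' q : HypCosets Γ η, poincareTerm k (hypLength Γ η ση) m ση (q.out : Γ) z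

/-- `c` is the family of parabolic Fourier coefficients `c_𝔞(n; f)`, `n ∈ ℤ`, of `f`:
`(f |_k σ_𝔞)(z) = ∑_{n ∈ ℤ} c n e^{2πinz}` on `ℍ`. -/
def IsParCoeffs (k : ℤ) (σa : SL(2, ℝ)) (f : ℍ → ℂ) (c : ℤ → ℂ) : Prop :=
  ∀ z : ℍ, HasSum (fun n : ℤ => c n * exp (2 * Real.pi * I * n * z))
    (slash k f σa z)

/-- `C_{η𝔞} = {ac : (a, b; c, d) ∈ σ_η⁻¹ Γ σ_𝔞}`. -/
def modSet (Γ : Subgroup SL(2, ℝ)) (ση σa : SL(2, ℝ)) : Set ℝ :=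
  {C | ∃ γ ∈ Γ, (ση⁻¹ * γ * σa) 0 0 * (ση⁻¹ * γ * σa) 1 0 = C}

/-- The set `Γ_η \ Γ / Γ_𝔞` of double cosets. -/
abbrev HypParDoubleCosets (Γ : Subgroup SL(2, ℝ)) (η : OnePoint ℝ × OnePoint ℝ)
    (𝔞 : OnePoint ℝ) : Type :=
  DoubleCoset.Quotient (pairFixer Γ η : Set Γ) (fixer Γ 𝔞 : Set Γ)

/-- The double cosets in `Γ_η \ Γ / Γ_𝔞` of those `γ` with `ac = C`, where
`σ_η⁻¹ γ σ_𝔞 = (a, b; c, d)`. The product `ac` does not depend on the representative `γ`. -/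
def doubleCosetsAt (Γ : Subgroup SL(2, ℝ)) (η : OnePoint ℝ × OnePoint ℝ) (ση : SL(2, ℝ))
    (𝔞 : OnePoint ℝ) (σa : SL(2, ℝ)) (C : ℝ) : Set (HypParDoubleCosets Γ η 𝔞) :=
  {q | (ση⁻¹ * (Quotient.out q : Γ) * σa) 0 0 * (ση⁻¹ * (Quotient.out q : Γ) * σa) 1 0 = C}

/-- `e((m/ℓ) log|a/c| + n (b/(2a) + d/(2c)))` for `M = (a, b; c, d)`, where `e(w) = e^{2πiw}`. -/
def kloostermanTerm (l : ℝ) (m n : ℤ) (M : SL(2, ℝ)) : ℂ :=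
  exp (2 * Real.pi * I *
    ((m / l * Real.log |M 0 0 / M 1 0| + n * (M 0 1 / (2 * M 0 0) + M 1 1 / (2 * M 1 0)) : ℝ) : ℂ))

/-- The hyperbolic/parabolic Kloosterman sum `S_{η𝔞}(m, n; C)`, a finite sum. -/
def kloosterman (Γ : Subgroup SL(2, ℝ)) (η : OnePoint ℝ × OnePoint ℝ) (ση : SL(2, ℝ))
    (𝔞 : OnePoint ℝ) (σa : SL(2, ℝ)) (m n : ℤ) (C : ℝ) : ℂ :=
  ∑ᶠ q ∈ doubleCosetsAt Γ η ση 𝔞 σa C,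
    kloostermanTerm (hypLength Γ η ση) m n (ση⁻¹ * (Quotient.out q : Γ) * σa)

/-- The integrand of `I_{η𝔞}(m, n; r)` at `u`; complex powers are principal. -/
def hypParIntegrand (k : ℤ) (l : ℝ) (m n : ℤ) (r : ℝ) (u : ℂ) : ℂ :=
  ((Real.sign r : ℂ) * ((u - r) / (u + r))) ^ (2 * Real.pi * I * m / l)
    * exp (-2 * Real.pi * I * n * u) / ((u - r) ^ ((k : ℂ) / 2) * (u + r) ^ ((k : ℂ) / 2))

/-- The integral `I_{η𝔞}(m, n; r)` along the horizontal line `Im u = y`. -/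
def hypParIntegral (k : ℤ) (l : ℝ) (m n : ℤ) (r y : ℝ) : ℂ :=
  ∫ x : ℝ, hypParIntegrand k l m n r (x + y * I)

/-- The summand `C^{-k/2} I_{η𝔞}(m, n; 1/(2C)) S_{η𝔞}(m, n; C)`. -/
def coeffTerm (Γ : Subgroup SL(2, ℝ)) (k : ℤ) (η : OnePoint ℝ × OnePoint ℝ) (ση : SL(2, ℝ))
    (𝔞 : OnePoint ℝ) (σa : SL(2, ℝ)) (m n : ℤ) (y C : ℝ) : ℂ :=
  (C : ℂ) ^ (-(k : ℂ) / 2) * hypParIntegral k (hypLength Γ η ση) m n (1 / (2 * C)) y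
    * kloosterman Γ η ση 𝔞 σa m n C

end HypPoincare

end

noncomputable section

namespace HypPoincare

/-! ### Discreteness -/

/-! Write k = 2κ, so κ ≥ 2. For M = (a, b; c, d) a term of the series is w^{2πim/ℓ} /
((az+b)(cz+d))^κ with w = Mz (`slash_eq_seriesTerm`). The power of w is bounded, and on sets with
bounded real part and height bounded below |az+b| and |cz+d| are comparable to |ai+b| and |ci+d|; so
every term is at most a constant times `wt M` (`norm_seriesTerm_le`).

Convergence is then an area argument. Left multiplication by Γ_η scales the point Mi by powers of
e^ℓ, so each coset has a representative with 1 ≤ |Mi| ≤ e^ℓ, where `wt M` ≤ (Im Mi)². Discs about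
these points with radius half the height lie in a fixed disc, and discreteness bounds their overlap,
so the sum of their areas is finite (`summable_wt_of_annulus`, `summable_wt`).

A fixed point of a hyperbolic element of Γ is not a cusp (`entry_zero_iff`), hence ac ≠ 0, and Γ_η\Γ
is the product of Γ_η\Γ/Γ_𝔞 with the integer translations (`cosetOf_bijective`). At the cusp the
series is therefore holomorphic and 1-periodic, and its Fourier coefficients are integrals over a
unit segment (`hasSum_fourier_iff`). Summing over translations unfolds each into integrals over a
whole horizontal line, one per double coset (`hasSum_integral_seriesTerm`). A real shift of the
variable moves the zeros of az+b and cz+d to ±1/(2ac), which splits each integral into an integral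
depending only on C = ac and a Kloosterman phase (`seriesTerm_mul_exp_eq`). Grouping by C gives the
formula. -/

/-- The elements of `SL₂(ℝ)` all of whose entries are bounded by `B`. -/
def boundedEntries (B : ℝ) : Set SL(2, ℝ) := {g | ∀ i j, |g i j| ≤ B}

lemma isCompact_boundedEntries (B : ℝ) : IsCompact (boundedEntries B) := by
  have hemb : Topology.IsClosedEmbedding
      (Subtype.val : SL(2, ℝ) → Matrix (Fin 2) (Fin 2) ℝ) := by
    refine Topology.IsClosedEmbedding.subtypeVal ?_
    exact isClosed_eq (Continuous.matrix_det continuous_id) continuous_const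
  have hK : IsCompact (Set.pi Set.univ fun _ : Fin 2 => Set.pi Set.univ fun _ : Fin 2 =>
      Set.Icc (-B) B) :=
    isCompact_univ_pi fun _ => isCompact_univ_pi fun _ => isCompact_Icc
  refine (hemb.isCompact_preimage hK).of_isClosed_subset ?_ fun g hg => ?_
  · simp only [boundedEntries, Set.ofPred_forall]
    refine isClosed_iInter fun i => isClosed_iInter fun j => isClosed_le ?_ continuous_const
    exact (hemb.continuous.matrix_elem i j).abs
  · exact fun i _ j _ => abs_le.1 (hg i j)

/-- A discrete subgroup meets each compact set in finitely many points; the fixed factors only move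
the compact set. -/
lemma finite_bounded (Γ : Subgroup SL(2, ℝ)) (hd : DiscreteTopology Γ) (h σ : SL(2, ℝ))
    (B : ℝ) : {γ : Γ | h * γ * σ ∈ boundedEntries B}.Finite := by
  have hK : IsCompact ((fun g : SL(2, ℝ) => h⁻¹ * g * σ⁻¹) '' boundedEntries B) :=
    (isCompact_boundedEntries B).image (by fun_prop)
  have hc := (Γ.tendsto_coe_cofinite_of_discrete ⟨hd⟩).eventually hK.compl_mem_cocompact
  rw [Filter.eventually_cofinite] at hc
  refine hc.subset fun γ hγ => ?_
  simp only [Set.mem_ofPred_eq, not_not] at hγ ⊢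
  exact ⟨_, hγ, by group⟩

/-! ### Points of the upper half-plane and the area bound -/

lemma det_entries (M : SL(2, ℝ)) : M 0 0 * M 1 1 - M 0 1 * M 1 0 = 1 := by
  have := M.det_coe
  rwa [Matrix.det_fin_two] at this

lemma mul_entries (A B : SL(2, ℝ)) (i j : Fin 2) :
    (A * B) i j = A i 0 * B 0 j + A i 1 * B 1 j := by
  rw [Matrix.SpecialLinearGroup.coe_mul, Matrix.mul_apply, Fin.sum_univ_two]

/-- `|ai + b|²` for the matrix `(a, b; c, d)`. -/
def topSq (M : SL(2, ℝ)) : ℝ := M 0 0 ^ 2 + M 0 1 ^ 2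

/-- `|ci + d|²` for the matrix `(a, b; c, d)`. -/
def botSq (M : SL(2, ℝ)) : ℝ := M 1 0 ^ 2 + M 1 1 ^ 2

/-- `ac + bd` for the matrix `(a, b; c, d)`. -/
def crossTerm (M : SL(2, ℝ)) : ℝ := M 0 0 * M 1 0 + M 0 1 * M 1 1

/-- Lagrange's identity with determinant one. Since Mi = (ac + bd + i)/|ci+d|², it links the modulus
of Mi to its coordinates. -/
lemma topSq_mul_botSq (M : SL(2, ℝ)) : topSq M * botSq M = 1 + crossTerm M ^ 2 := by
  have := det_entries M
  simp only [topSq, botSq, crossTerm]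
  linear_combination (M 0 0 * M 1 1 - M 0 1 * M 1 0 + 1) * this

lemma topSq_nonneg (M : SL(2, ℝ)) : 0 ≤ topSq M := by unfold topSq; positivity

lemma botSq_nonneg (M : SL(2, ℝ)) : 0 ≤ botSq M := by unfold botSq; positivity

lemma one_le_topSq_mul_botSq (M : SL(2, ℝ)) : 1 ≤ topSq M * botSq M := by
  rw [topSq_mul_botSq]; nlinarith [sq_nonneg (crossTerm M)]

lemma topSq_pos (M : SL(2, ℝ)) : 0 < topSq M := by
  rcases (topSq_nonneg M).eq_or_lt with h | h
  · have := one_le_topSq_mul_botSq M; rw [← h] at this; linarith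
  · exact h

lemma botSq_pos (M : SL(2, ℝ)) : 0 < botSq M := by
  rcases (botSq_nonneg M).eq_or_lt with h | h
  · have := one_le_topSq_mul_botSq M; rw [← h] at this; linarith
  · exact h

/-- The quantity `1 / (|ai + b|² |ci + d|²)`, which dominates the terms of the series. -/
def wt (M : SL(2, ℝ)) : ℝ := 1 / (topSq M * botSq M)

lemma wt_nonneg (M : SL(2, ℝ)) : 0 ≤ wt M := by
  have := one_le_topSq_mul_botSq M
  unfold wt; positivity

/-- The Euclidean disc around the point `M i` with radius half its height. -/
def halfDisc (M : SL(2, ℝ)) : Set ℂ :=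
  Metric.ball (⟨crossTerm M / botSq M, 1 / botSq M⟩ : ℂ) (1 / botSq M / 2)

/-- The squared Euclidean norm of g is 2 cosh d(i, gi); for g = A⁻¹M this is 2 cosh d(Ai, Mi), here
written through the coordinates of Ai and Mi. -/
lemma sq_entries_inv_mul (A M : SL(2, ℝ)) :
    (A⁻¹ * M) 0 0 ^ 2 + (A⁻¹ * M) 0 1 ^ 2 + (A⁻¹ * M) 1 0 ^ 2 + (A⁻¹ * M) 1 1 ^ 2 =
      topSq M * botSq A + botSq M * topSq A - 2 * crossTerm M * crossTerm A := by
  have e (i j) : (A⁻¹ * M) i j = A⁻¹ i 0 * M 0 j + A⁻¹ i 1 * M 1 j := mul_entries _ _ _ _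
  simp only [e, topSq, botSq, crossTerm, Matrix.SpecialLinearGroup.coe_inv,
    Matrix.adjugate_fin_two, Matrix.of_apply, Matrix.cons_val', Matrix.cons_val_zero,
    Matrix.cons_val_one, Matrix.cons_val_fin_one]
  ring

/-- If the half-height discs about Ai and Mi meet, the two points are at bounded hyperbolic
distance, so A⁻¹M has bounded norm. -/
lemma inv_mul_mem_boundedEntries {A M : SL(2, ℝ)} {p : ℂ} (hA : p ∈ halfDisc A)
    (hM : p ∈ halfDisc M) : A⁻¹ * M ∈ boundedEntries 3 := by
  have key : ∀ {x v x₀ v₀ s t : ℝ}, 0 < v → 0 < v₀ → (s - x) ^ 2 + (t - v) ^ 2 < (v / 2) ^ 2 →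
      (s - x₀) ^ 2 + (t - v₀) ^ 2 < (v₀ / 2) ^ 2 →
      (x - x₀) ^ 2 + v ^ 2 + v₀ ^ 2 ≤ 9 * (v * v₀) := by
    intro x v x₀ v₀ s t hv hv₀ h h₀
    have h1 := abs_lt_of_sq_lt_sq (show (s - x) ^ 2 < (v / 2) ^ 2 by nlinarith [sq_nonneg (t - v)])
      (by positivity)
    have h2 := abs_lt_of_sq_lt_sq (show (t - v) ^ 2 < (v / 2) ^ 2 by nlinarith [sq_nonneg (s - x)])
      (by positivity)
    have h3 := abs_lt_of_sq_lt_sq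
      (show (s - x₀) ^ 2 < (v₀ / 2) ^ 2 by nlinarith [sq_nonneg (t - v₀)]) (by positivity)
    have h4 := abs_lt_of_sq_lt_sq
      (show (t - v₀) ^ 2 < (v₀ / 2) ^ 2 by nlinarith [sq_nonneg (s - x₀)]) (by positivity)
    rw [abs_lt] at h1 h2 h3 h4
    have h5 : (x - x₀) ^ 2 ≤ ((v + v₀) / 2) ^ 2 := by
      apply sq_le_sq'  <;> linarith
    -- A common point has height t with v/2 < t < 3v₀/2 and v₀/2 < t < 3v/2, so each height is less
    -- than three times the other.
    have h6 : 0 ≤ (3 * v - v₀) * (3 * v₀ - v) :=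
      mul_nonneg (by linarith) (by linarith)
    nlinarith
  have mem (B : SL(2, ℝ)) (hB : p ∈ halfDisc B) :
      (p.re - crossTerm B / botSq B) ^ 2 + (p.im - 1 / botSq B) ^ 2 < (1 / botSq B / 2) ^ 2 := by
    have h0 := botSq_pos B
    rw [halfDisc, Metric.mem_ball, dist_eq_norm, Complex.norm_def,
      Real.sqrt_lt' (by positivity), Complex.normSq_apply] at hB
    simpa [sq] using hB
  have h0A := botSq_pos A
  have h0M := botSq_pos M
  have h := key (by positivity) (by positivity) (mem M hM) (mem A hA)
  have htot : (A⁻¹ * M) 0 0 ^ 2 + (A⁻¹ * M) 0 1 ^ 2 + (A⁻¹ * M) 1 0 ^ 2 + (A⁻¹ * M) 1 1 ^ 2 ≤ 9 := by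
    rw [sq_entries_inv_mul]
    have hA' := topSq_mul_botSq A
    have hM' := topSq_mul_botSq M
    have e1 : topSq A = (1 + crossTerm A ^ 2) / botSq A := by field_simp; linarith
    have e2 : topSq M = (1 + crossTerm M ^ 2) / botSq M := by field_simp; linarith
    rw [e1, e2]
    have h' := mul_le_mul_of_nonneg_right h (show 0 ≤ botSq M * botSq A by positivity)
    have e3 : 9 * (1 / botSq M * (1 / botSq A)) * (botSq M * botSq A) = 9 := by field_simp
    rw [e3] at h'
    refine le_trans (le_of_eq ?_) h'
    field_simp
    ring
  intro i j
  apply abs_le_of_sq_le_sq _ (by norm_num)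
  fin_cases i <;> fin_cases j <;>
    simp only [Fin.zero_eta, Fin.mk_one, Fin.isValue] <;>
    nlinarith [sq_nonneg ((A⁻¹ * M) 0 0), sq_nonneg ((A⁻¹ * M) 0 1), sq_nonneg ((A⁻¹ * M) 1 0),
      sq_nonneg ((A⁻¹ * M) 1 1)]

/-- Discs with bounded overlap inside a fixed disc have bounded total area. -/
lemma sum_sq_radius_le {ι : Type*} (s : Finset ι) (c : ι → ℂ) (r : ι → ℝ) (hr : ∀ i, 0 ≤ r i)
    (N : ℕ) (R : ℝ) (hR : 0 ≤ R) (hsub : ∀ i ∈ s, Metric.ball (c i) (r i) ⊆ Metric.ball 0 R)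
    (hN : ∀ p : ℂ, ∀ u ⊆ s, (∀ i ∈ u, p ∈ Metric.ball (c i) (r i)) → u.card ≤ N) :
    ∑ i ∈ s, r i ^ 2 ≤ N * R ^ 2 := by
  classical
  -- Integrate the number of discs covering p: it is at most N, and vanishes outside the large disc.
  have h1 : ∑ i ∈ s, volume (Metric.ball (c i) (r i)) ≤ N * volume (Metric.ball (0 : ℂ) R) := by
    calc ∑ i ∈ s, volume (Metric.ball (c i) (r i))
        = ∑ i ∈ s, ∫⁻ p, (Metric.ball (c i) (r i)).indicator 1 p := by
          refine Finset.sum_congr rfl fun i _ => ?_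
          rw [lintegral_indicator_one Metric.isOpen_ball.measurableSet]
      _ = ∫⁻ p, ∑ i ∈ s, (Metric.ball (c i) (r i)).indicator 1 p := by
          rw [lintegral_finsetSum]
          exact fun i _ => measurable_one.indicator Metric.isOpen_ball.measurableSet
      _ ≤ ∫⁻ p, N * (Metric.ball (0 : ℂ) R).indicator 1 p := by
          refine lintegral_mono fun p => ?_
          have hs : ∑ i ∈ s, (Metric.ball (c i) (r i)).indicator (1 : ℂ → ENNReal) p =
              ((s.filter fun i => p ∈ Metric.ball (c i) (r i)).card : ENNReal) := by
            rw [Finset.card_filter, Nat.cast_sum]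
            refine Finset.sum_congr rfl fun i _ => ?_
            by_cases hp : p ∈ Metric.ball (c i) (r i) <;> simp [hp]
          simp only [hs]
          by_cases hp : p ∈ Metric.ball (0 : ℂ) R
          · rw [Set.indicator_of_mem hp]
            simp only [Pi.one_apply, mul_one, Nat.cast_le]
            exact hN p _ (Finset.filter_subset _ _) fun i hi => (Finset.mem_filter.1 hi).2
          · have : s.filter (fun i => p ∈ Metric.ball (c i) (r i)) = ∅ :=
              Finset.filter_eq_empty_iff.2 fun i hi h => hp (hsub i hi h)
            rw [this]
            simp
      _ = N * volume (Metric.ball (0 : ℂ) R) := by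
          rw [lintegral_const_mul _ (measurable_one.indicator Metric.isOpen_ball.measurableSet),
            lintegral_indicator_one Metric.isOpen_ball.measurableSet]
  have hpi : ENNReal.ofReal Real.pi = (NNReal.pi : ENNReal) := by
    rw [← ENNReal.ofReal_coe_nnreal]; rfl
  simp only [Complex.volume_ball] at h1
  rw [← Finset.sum_mul, ← mul_assoc,
    ENNReal.mul_le_mul_iff_left (by simpa using NNReal.pi_ne_zero) (by simp)] at h1
  simp only [← ENNReal.ofReal_pow (hr _), ← ENNReal.ofReal_pow hR] at h1
  rw [← ENNReal.ofReal_sum_of_nonneg (fun i _ => by positivity), ← ENNReal.ofReal_natCast,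
    ← ENNReal.ofReal_mul (by positivity), ENNReal.ofReal_le_ofReal_iff (by positivity)] at h1
  exact h1

/-- For a discrete group the weights are summable over group elements whose associated points
stay in a half-annulus. -/
lemma summable_wt_of_annulus (Γ : Subgroup SL(2, ℝ)) (hd : DiscreteTopology Γ) (g σ : SL(2, ℝ))
    {ι : Type*} (γ : ι → Γ) (hγ : Function.Injective γ) (R : ℝ)
    (h1 : ∀ i, botSq (g * γ i * σ) ≤ topSq (g * γ i * σ))
    (h2 : ∀ i, topSq (g * γ i * σ) ≤ R ^ 2 * botSq (g * γ i * σ)) (hR : 0 ≤ R) :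
    Summable fun i => wt (g * γ i * σ) := by
  classical
  set E := (finite_bounded Γ hd σ⁻¹ σ 3).toFinset with hE
  -- Outside the unit disc the weight is at most the squared height of Mi, that is, four times the
  -- squared radius of its disc.
  have hv (M : SL(2, ℝ)) (hM : botSq M ≤ topSq M) : wt M ≤ 4 * (1 / botSq M / 2) ^ 2 := by
    have := botSq_pos M
    have e : 4 * (1 / botSq M / 2) ^ 2 = 1 / (botSq M * botSq M) := by field_simp; norm_num
    rw [e, wt]
    exact one_div_le_one_div_of_le (by positivity) (by gcongr)
  refine summable_of_sum_le (c := 4 * (E.card * (2 * R) ^ 2)) (fun i => wt_nonneg _) fun s => ?_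
  refine (Finset.sum_le_sum fun i _ => hv _ (h1 i)).trans ?_
  rw [← Finset.mul_sum]
  refine mul_le_mul_of_nonneg_left ?_ (by norm_num)
  refine sum_sq_radius_le s
    (fun i => ⟨crossTerm (g * γ i * σ) / botSq (g * γ i * σ), 1 / botSq (g * γ i * σ)⟩)
    (fun i => 1 / botSq (g * γ i * σ) / 2)
    (fun i => by have := botSq_pos (g * γ i * σ); positivity) E.card (2 * R) (by positivity) ?_ ?_
  -- The centre has modulus at most R and the radius is at most R/2, so the disc lies within radius
  -- 2R.
  · intro i _ p hp
    set M := g * γ i * σ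
    have h0 := botSq_pos M
    have hn : ‖(⟨crossTerm M / botSq M, 1 / botSq M⟩ : ℂ)‖ ≤ R := by
      rw [Complex.norm_def, Real.sqrt_le_left hR, Complex.normSq_apply]
      have : crossTerm M / botSq M * (crossTerm M / botSq M) + 1 / botSq M * (1 / botSq M) =
          topSq M / botSq M := by
        have := topSq_mul_botSq M
        field_simp
        linarith
      simp only [this]
      rw [div_le_iff₀ h0]
      exact h2 i
    have him : 1 / botSq M ≤ ‖(⟨crossTerm M / botSq M, 1 / botSq M⟩ : ℂ)‖ := by
      refine le_trans (le_abs_self _) (Complex.abs_im_le_norm ⟨crossTerm M / botSq M, 1 / botSq M⟩)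
    rw [Metric.mem_ball, dist_eq_norm] at hp
    rw [Metric.mem_ball, dist_zero_right]
    have := norm_sub_norm_le p ⟨crossTerm M / botSq M, 1 / botSq M⟩
    have hpos : 0 < 1 / botSq M := by positivity
    linarith
  · intro p u _ hp
    rcases u.eq_empty_or_nonempty with rfl | ⟨i₀, hi₀⟩
    · simp
    -- Fix one disc through p. Left translation by the inverse of its group element injects the
    -- others into the finite set E.
    refine Finset.card_le_card_of_injOn (fun i => (γ i₀)⁻¹ * γ i) (fun i hi => ?_) ?_
    · rw [Finset.mem_coe, hE, Set.Finite.mem_toFinset, Set.mem_ofPred_eq]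
      have := inv_mul_mem_boundedEntries (hp i₀ hi₀) (hp i hi)
      convert this using 1
      push_cast
      group
    · intro i _ j _ hij
      exact hγ (mul_left_cancel hij)

section

/-! ### Diagonal and unipotent matrices -/

lemma sl_ext {A B : SL(2, ℝ)} (h00 : A 0 0 = B 0 0) (h01 : A 0 1 = B 0 1) (h10 : A 1 0 = B 1 0)
    (h11 : A 1 1 = B 1 1) : A = B := by
  ext i j
  fin_cases i <;> fin_cases j <;> assumption

lemma neg_entries (A : SL(2, ℝ)) (i j : Fin 2) : (-A) i j = -A i j := by
  rw [Matrix.SpecialLinearGroup.coe_neg, Matrix.neg_apply]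

@[simp] lemma dilMat_00 (t : ℝ) : dilMat t 0 0 = Real.exp (t / 2) := rfl
@[simp] lemma dilMat_01 (t : ℝ) : dilMat t 0 1 = 0 := rfl
@[simp] lemma dilMat_10 (t : ℝ) : dilMat t 1 0 = 0 := rfl
@[simp] lemma dilMat_11 (t : ℝ) : dilMat t 1 1 = Real.exp (-(t / 2)) := rfl
@[simp] lemma transMat_00 (t : ℝ) : transMat t 0 0 = 1 := rfl
@[simp] lemma transMat_01 (t : ℝ) : transMat t 0 1 = t := rfl
@[simp] lemma transMat_10 (t : ℝ) : transMat t 1 0 = 0 := rfl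
@[simp] lemma transMat_11 (t : ℝ) : transMat t 1 1 = 1 := rfl

lemma dilMat_zero : dilMat 0 = 1 := by
  apply sl_ext <;> simp

lemma dilMat_add (s t : ℝ) : dilMat (s + t) = dilMat s * dilMat t := by
  apply sl_ext <;> simp [mul_entries, ← Real.exp_add] <;> ring_nf

lemma dilMat_neg (t : ℝ) : dilMat (-t) = (dilMat t)⁻¹ := by
  rw [eq_inv_iff_mul_eq_one, ← dilMat_add, neg_add_cancel, dilMat_zero]

lemma transMat_add (s t : ℝ) : transMat (s + t) = transMat s * transMat t := by
  apply sl_ext <;> simp [mul_entries, add_comm]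

lemma transMat_zero : transMat 0 = 1 := by
  apply sl_ext <;> simp

lemma transMat_neg (t : ℝ) : transMat (-t) = (transMat t)⁻¹ := by
  rw [eq_inv_iff_mul_eq_one, ← transMat_add, neg_add_cancel, transMat_zero]

lemma exists_dilMat_of_diagonal (g : SL(2, ℝ)) (h01 : g 0 1 = 0) (h10 : g 1 0 = 0) :
    ∃ l, g = dilMat l ∨ g = -dilMat l := by
  have hdet := det_entries g
  rw [h01, zero_mul, sub_zero] at hdet
  have h0 : g 0 0 ≠ 0 := left_ne_zero_of_mul_eq_one hdet
  have h11 : g 1 1 = (g 0 0)⁻¹ := eq_inv_of_mul_eq_one_right hdet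
  refine ⟨2 * Real.log |g 0 0|, ?_⟩
  have e : Real.exp (2 * Real.log |g 0 0| / 2) = |g 0 0| := by
    rw [mul_div_cancel_left₀ _ two_ne_zero, Real.exp_log (abs_pos.2 h0)]
  rcases lt_or_gt_of_ne h0 with h | h
  · right
    rw [abs_of_neg h] at e ⊢
    apply sl_ext <;> simp only [neg_entries, dilMat_00, dilMat_01, dilMat_10, dilMat_11, h01, h10,
      Real.exp_neg, e, h11, neg_zero, neg_neg, inv_neg]
  · left
    rw [abs_of_pos h] at e ⊢
    apply sl_ext <;> simp only [dilMat_00, dilMat_01, dilMat_10, dilMat_11, h01, h10,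
      Real.exp_neg, e, h11]

lemma topSq_dilMat_mul (t : ℝ) (M : SL(2, ℝ)) : topSq (dilMat t * M) = Real.exp t * topSq M := by
  have : Real.exp t = Real.exp (t / 2) ^ 2 := by rw [← Real.exp_nat_mul]; congr 1; push_cast; ring
  simp only [topSq, mul_entries, dilMat_00, dilMat_01, this]
  ring

lemma botSq_dilMat_mul (t : ℝ) (M : SL(2, ℝ)) : botSq (dilMat t * M) = Real.exp (-t) * botSq M := by
  have : Real.exp (-t) = Real.exp (-(t / 2)) ^ 2 := by
    rw [← Real.exp_nat_mul]; congr 1; push_cast; ring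
  simp only [botSq, mul_entries, dilMat_10, dilMat_11, this]
  ring

lemma topSq_neg (M : SL(2, ℝ)) : topSq (-M) = topSq M := by simp [topSq, neg_entries]

lemma botSq_neg (M : SL(2, ℝ)) : botSq (-M) = botSq M := by simp [botSq, neg_entries]

lemma wt_neg (M : SL(2, ℝ)) : wt (-M) = wt M := by rw [wt, wt, topSq_neg, botSq_neg]

lemma wt_dilMat_mul (t : ℝ) (M : SL(2, ℝ)) : wt (dilMat t * M) = wt M := by
  rw [wt, wt, topSq_dilMat_mul, botSq_dilMat_mul, mul_mul_mul_comm, ← Real.exp_add, add_neg_cancel,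
    Real.exp_zero, one_mul]

/-! ### Stabilizers -/

lemma bdry_infty_eq_iff (g : SL(2, ℝ)) : bdry g OnePoint.infty = OnePoint.infty ↔ g 1 0 = 0 := by
  rw [bdry, OnePoint.smul_infty_eq_self_iff]
  rfl

lemma bdry_zero_eq_iff (g : SL(2, ℝ)) :
    bdry g ((0 : ℝ) : OnePoint ℝ) = ((0 : ℝ) : OnePoint ℝ) ↔ g 0 1 = 0 := by
  have hdet := det_entries g
  rw [bdry, OnePoint.smul_some_eq_ite]
  change (if g 1 0 * 0 + g 1 1 = 0 then OnePoint.infty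
    else (((g 0 0 * 0 + g 0 1) / (g 1 0 * 0 + g 1 1) : ℝ) : OnePoint ℝ)) = _ ↔ _
  simp only [mul_zero, zero_add]
  by_cases h : g 1 1 = 0
  · rw [if_pos h]
    refine iff_of_false (OnePoint.infty_ne_coe 0) fun h' => ?_
    simp [h, h'] at hdet
  · rw [if_neg h, OnePoint.coe_eq_coe, div_eq_zero_iff]
    simp [h]

lemma bdry_fixed_iff_conj {σ : SL(2, ℝ)} {x₀ x : OnePoint ℝ} (hσ : bdry σ x₀ = x) (γ : SL(2, ℝ)) :
    bdry γ x = x ↔ bdry (σ⁻¹ * γ * σ) x₀ = x₀ := by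
  have hinv : bdry σ⁻¹ x = x₀ := by rw [← hσ, ← bdry_mul, inv_mul_cancel, bdry_one]
  rw [bdry_mul, hσ, bdry_mul]
  constructor
  · intro h; rw [h, hinv]
  · intro h
    have := congrArg (bdry σ) h
    rwa [← bdry_mul σ, mul_inv_cancel, bdry_one, hσ] at this

variable {Γ : Subgroup SL(2, ℝ)} {η : OnePoint ℝ × OnePoint ℝ} {ση : SL(2, ℝ)}

lemma mem_pairFixer_iff (hση : IsHypScaling η ση) (γ : Γ) :
    γ ∈ pairFixer Γ η ↔ (ση⁻¹ * γ * ση) 0 1 = 0 ∧ (ση⁻¹ * γ * ση) 1 0 = 0 := by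
  rw [← bdry_zero_eq_iff, ← bdry_infty_eq_iff, ← bdry_fixed_iff_conj hση.1,
    ← bdry_fixed_iff_conj hση.2]
  rfl

lemma exists_dilMat_of_mem (hση : IsHypScaling η ση) {γ : Γ} (hγ : γ ∈ pairFixer Γ η) :
    ∃ l, ση⁻¹ * γ * ση = dilMat l ∨ ση⁻¹ * γ * ση = -dilMat l :=
  exists_dilMat_of_diagonal _ ((mem_pairFixer_iff hση γ).1 hγ).1 ((mem_pairFixer_iff hση γ).1 hγ).2

variable (Γ η ση) in
/-- The group of signed translation lengths of the elements of `Γ_η`. -/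
def lengthGroup : AddSubgroup ℝ where
  carrier := {l | ∃ γ ∈ pairFixer Γ η, ση⁻¹ * γ * ση = dilMat l ∨ ση⁻¹ * γ * ση = -dilMat l}
  zero_mem' := ⟨1, one_mem _, Or.inl (by simp [dilMat_zero])⟩
  add_mem' {s t} := by
    rintro ⟨γ, hγ, h⟩ ⟨δ, hδ, h'⟩
    have e : ση⁻¹ * (γ * δ : Γ) * ση = (ση⁻¹ * γ * ση) * (ση⁻¹ * δ * ση) := by push_cast; group
    refine ⟨γ * δ, mul_mem hγ hδ, ?_⟩
    rw [e, dilMat_add]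
    rcases h with h | h <;> rcases h' with h' | h' <;> simp [h, h']
  neg_mem' {t} := by
    rintro ⟨γ, hγ, h⟩
    have e : ση⁻¹ * (γ⁻¹ : Γ) * ση = (ση⁻¹ * γ * ση)⁻¹ := by push_cast; group
    refine ⟨γ⁻¹, inv_mem hγ, ?_⟩
    rw [e, dilMat_neg]
    rcases h with h | h
    · exact Or.inl (by rw [h])
    · exact Or.inr (by rw [h, inv_eq_iff_eq_inv, ← mul_eq_one_iff_eq_inv, neg_mul_neg,
        mul_inv_cancel])

/-- The length group is nonzero, because a hyperbolic element is not ±I, and has no small positive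
elements, because Γ is discrete. So it is infinite cyclic and the infimum is attained. -/
lemma isLeast_hypLength (hd : DiscreteTopology Γ) (hη : IsHypPair Γ η) (hση : IsHypScaling η ση) :
    IsLeast {l | l ∈ lengthGroup Γ η ση ∧ 0 < l} (hypLength Γ η ση) := by
  have hne : lengthGroup Γ η ση ≠ ⊥ := by
    obtain ⟨-, γ, hγ, hhyp, h1, h2⟩ := hη
    have hmem : (⟨γ, hγ⟩ : Γ) ∈ pairFixer Γ η := ⟨h1, h2⟩
    obtain ⟨l, hl⟩ := exists_dilMat_of_mem hση hmem
    intro hbot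
    have hl0 : l = 0 := by
      rw [← AddSubgroup.mem_bot, ← hbot]
      exact ⟨_, hmem, hl⟩
    rw [hl0, dilMat_zero] at hl
    have hγ1 : γ = 1 ∨ γ = -1 := by
      have e : γ = ση * (ση⁻¹ * γ * ση) * ση⁻¹ := by group
      rcases hl with hl | hl <;> rw [e] <;> simp only at hl <;> rw [hl] <;> simp
    rw [Matrix.IsHyperbolic, Matrix.discr_fin_two, Matrix.trace_fin_two, γ.det_coe] at hhyp
    rcases hγ1 with rfl | rfl <;> norm_num at hhyp
  obtain ⟨a, ha, hdisj⟩ : ∃ a : ℝ, 0 < a ∧ Disjoint (lengthGroup Γ η ση : Set ℝ) (Set.Ioo 0 a) := by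
    set S : Set ℝ := {l | l ∈ lengthGroup Γ η ση ∧ l ∈ Set.Ioo (0 : ℝ) 1} with hSdef
    have hS : S.Finite := by
      refine ((finite_bounded Γ hd ση⁻¹ ση (Real.exp 1)).image
        fun γ : Γ => 2 * Real.log |(ση⁻¹ * γ * ση) 0 0|).subset ?_
      rintro l ⟨⟨γ, -, hl⟩, hl0, hl1⟩
      have h1 : Real.exp (l / 2) ≤ Real.exp 1 := Real.exp_le_exp.2 (by linarith)
      have h2 : Real.exp (-(l / 2)) ≤ Real.exp 1 := Real.exp_le_exp.2 (by linarith)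
      have h3 : 0 ≤ Real.exp 1 := (Real.exp_pos _).le
      refine ⟨γ, fun i j => ?_, ?_⟩
      · rcases hl with hl | hl <;> rw [hl] <;> fin_cases i <;> fin_cases j <;>
          simp [neg_entries, h1, h2, h3]
      · rcases hl with hl | hl <;> simp only [hl, neg_entries, abs_neg, dilMat_00, Real.abs_exp,
          Real.log_exp] <;> ring
    obtain ⟨ε, hε, hball⟩ := Metric.mem_nhds_iff.1
      (hS.isClosed.isOpen_compl.mem_nhds (fun h => lt_irrefl _ h.2.1 : (0 : ℝ) ∈ Sᶜ))
    refine ⟨min ε 1, by positivity, Set.disjoint_left.2 fun l hl hl' => ?_⟩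
    refine hball (?_ : l ∈ Metric.ball 0 ε) ⟨hl, hl'.1, hl'.2.trans_le (min_le_right _ _)⟩
    rw [mem_ball_zero_iff, Real.norm_eq_abs, abs_of_pos hl'.1]
    exact hl'.2.trans_le (min_le_left _ _)
  obtain ⟨b, hb⟩ := AddSubgroup.exists_isLeast_pos hne ha hdisj
  have : hypLength Γ η ση = b := by
    have e : {g | g ∈ lengthGroup Γ η ση ∧ 0 < g} = {l : ℝ | 0 < l ∧ ∃ γ ∈ pairFixer Γ η,
        ση⁻¹ * γ * ση = dilMat l ∨ ση⁻¹ * γ * ση = -dilMat l} := by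
      ext l
      exact and_comm
    rw [e] at hb
    exact hb.csInf_eq
  rwa [this]

lemma hypLength_pos (hd : DiscreteTopology Γ) (hη : IsHypPair Γ η) (hση : IsHypScaling η ση) :
    0 < hypLength Γ η ση := (isLeast_hypLength hd hη hση).1.2

lemma exists_int_of_mem (hd : DiscreteTopology Γ) (hη : IsHypPair Γ η) (hση : IsHypScaling η ση)
    {γ : Γ} (hγ : γ ∈ pairFixer Γ η) :
    ∃ j : ℤ, ση⁻¹ * γ * ση = dilMat (j * hypLength Γ η ση) ∨
      ση⁻¹ * γ * ση = -dilMat (j * hypLength Γ η ση) := by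
  obtain ⟨l, hl⟩ := exists_dilMat_of_mem hση hγ
  have hmem : l ∈ lengthGroup Γ η ση := ⟨γ, hγ, hl⟩
  rw [AddSubgroup.cyclic_of_min (isLeast_hypLength hd hη hση), AddSubgroup.mem_closure_singleton]
    at hmem
  obtain ⟨j, rfl⟩ := hmem
  exact ⟨j, by simpa using hl⟩

lemma exists_mem_of_int (hd : DiscreteTopology Γ) (hη : IsHypPair Γ η) (hση : IsHypScaling η ση)
    (j : ℤ) : ∃ γ ∈ pairFixer Γ η, ση⁻¹ * γ * ση = dilMat (j * hypLength Γ η ση) ∨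
      ση⁻¹ * γ * ση = -dilMat (j * hypLength Γ η ση) := by
  have := zsmul_mem (isLeast_hypLength hd hη hση).1.1 j
  rw [zsmul_eq_mul] at this
  exact this

/-! ### Cosets of the hyperbolic stabilizer -/

lemma mk_eq_mk_iff (γ δ : Γ) :
    (Quotient.mk (QuotientGroup.rightRel (pairFixer Γ η)) γ =
      Quotient.mk (QuotientGroup.rightRel (pairFixer Γ η)) δ) ↔ δ * γ⁻¹ ∈ pairFixer Γ η := by
  rw [Quotient.eq, QuotientGroup.rightRel_apply]

/-- A function on `Γ` that is left invariant under `Γ_η` can be evaluated at representatives. -/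
lemma apply_out_mk {α : Type*} (f : Γ → α) (hf : ∀ h ∈ pairFixer Γ η, ∀ γ, f (h * γ) = f γ)
    (γ : Γ) : f (Quotient.mk (QuotientGroup.rightRel (pairFixer Γ η)) γ).out = f γ := by
  have h := (mk_eq_mk_iff (η := η) _ _).1
    (Quotient.out_eq (Quotient.mk (QuotientGroup.rightRel (pairFixer Γ η)) γ))
  have := hf _ h (Quotient.mk (QuotientGroup.rightRel (pairFixer Γ η)) γ).out
  rw [inv_mul_cancel_right] at this
  exact this.symm

lemma conj_mul (h γ : Γ) (σ : SL(2, ℝ)) :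
    ση⁻¹ * (h * γ : Γ) * σ = (ση⁻¹ * h * ση) * (ση⁻¹ * γ * σ) := by
  push_cast; group

lemma wt_mul_of_mem (hση : IsHypScaling η ση) (σ : SL(2, ℝ)) {h : Γ} (hh : h ∈ pairFixer Γ η)
    (γ : Γ) : wt (ση⁻¹ * (h * γ : Γ) * σ) = wt (ση⁻¹ * γ * σ) := by
  rw [conj_mul]
  obtain ⟨l, hl | hl⟩ := exists_dilMat_of_mem hση hh <;> rw [hl]
  · rw [wt_dilMat_mul]
  · rw [neg_mul, wt_neg, wt_dilMat_mul]

/-- The weight is constant on Γ_η-cosets, so representatives may be chosen with their points in one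
half-annulus. -/
theorem summable_wt (hd : DiscreteTopology Γ) (hη : IsHypPair Γ η) (hση : IsHypScaling η ση)
    (σ : SL(2, ℝ)) : Summable fun q : HypCosets Γ η => wt (ση⁻¹ * (q.out : Γ) * σ) := by
  set ℓ := hypLength Γ η ση with hℓ
  have hℓ0 : 0 < ℓ := hypLength_pos hd hη hση
  have hrep : ∀ q : HypCosets Γ η, ∃ γ : Γ, Quotient.mk _ γ = q ∧
      botSq (ση⁻¹ * γ * σ) ≤ topSq (ση⁻¹ * γ * σ) ∧
      topSq (ση⁻¹ * γ * σ) ≤ Real.exp ℓ ^ 2 * botSq (ση⁻¹ * γ * σ) := by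
    intro q
    set M := ση⁻¹ * (q.out : Γ) * σ
    have ht := topSq_pos M
    have hb := botSq_pos M
    -- `topSq / botSq` is |Mi|², which the generator of Γ_η scales by e^{2ℓ}; the power -j brings it
    -- into [1, e^{2ℓ}).
    obtain ⟨j, hj1, hj2⟩ := exists_mem_Ico_zpow (x := topSq M / botSq M) (y := Real.exp (2 * ℓ))
      (by positivity) (Real.one_lt_exp_iff.2 (by positivity))
    obtain ⟨h, hh, hl⟩ := exists_mem_of_int hd hη hση (-j)
    refine ⟨h * q.out, ?_, ?_⟩
    · conv_rhs => rw [← Quotient.out_eq q]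
      rw [mk_eq_mk_iff, mul_inv_rev, mul_inv_cancel_left]
      exact inv_mem hh
    · rw [← hℓ] at hl
      have e1 : topSq (ση⁻¹ * (h * q.out : Γ) * σ) = Real.exp ((-j : ℤ) * ℓ) * topSq M := by
        rw [conj_mul]
        rcases hl with hl | hl <;> rw [hl]
        · rw [topSq_dilMat_mul]
        · rw [neg_mul, topSq_neg, topSq_dilMat_mul]
      have e2 : botSq (ση⁻¹ * (h * q.out : Γ) * σ) = Real.exp (-((-j : ℤ) * ℓ)) * botSq M := by
        rw [conj_mul]
        rcases hl with hl | hl <;> rw [hl]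
        · rw [botSq_dilMat_mul]
        · rw [neg_mul, botSq_neg, botSq_dilMat_mul]
      rw [e1, e2]
      rw [← Real.rpow_intCast, ← Real.exp_mul, mul_comm (2 * ℓ), le_div_iff₀ hb] at hj1
      rw [← Real.rpow_intCast, ← Real.exp_mul, mul_comm (2 * ℓ), div_lt_iff₀ hb] at hj2
      have hE := Real.exp_pos ((-j : ℤ) * ℓ)
      constructor
      · calc Real.exp (-((-j : ℤ) * ℓ)) * botSq M
            = Real.exp ((-j : ℤ) * ℓ) * (Real.exp (j * (2 * ℓ)) * botSq M) := by
              rw [← mul_assoc, ← Real.exp_add]; congr 2; push_cast; ring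
          _ ≤ _ := by gcongr
      · calc Real.exp ((-j : ℤ) * ℓ) * topSq M
            ≤ Real.exp ((-j : ℤ) * ℓ) * (Real.exp ((j + 1 : ℤ) * (2 * ℓ)) * botSq M) := by gcongr
          _ = _ := by
              rw [← Real.exp_nat_mul, ← mul_assoc (Real.exp _), ← mul_assoc (Real.exp _),
                ← Real.exp_add, ← Real.exp_add]
              congr 2; push_cast; ring
  choose γ hγ hγ1 hγ2 using hrep
  have hinj : Function.Injective γ := Function.LeftInverse.injective hγ
  have hout (q : HypCosets Γ η) : wt (ση⁻¹ * (q.out : Γ) * σ) = wt (ση⁻¹ * γ q * σ) := by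
    have := apply_out_mk (η := η) (fun γ : Γ => wt (ση⁻¹ * γ * σ))
      (fun h hh γ => wt_mul_of_mem hση σ hh γ) (γ q)
    rwa [hγ q] at this
  simp only [hout]
  exact summable_wt_of_annulus Γ hd ση⁻¹ σ γ hinj (Real.exp ℓ) hγ1 hγ2 (Real.exp_pos _).le

end

section

variable {Γ : Subgroup SL(2, ℝ)} {η : OnePoint ℝ × OnePoint ℝ} {ση : SL(2, ℝ)}

/-! ### Hyperbolic fixed points are not cusps -/

lemma conj_eq_dilMat_conj {h u : Γ} {t : ℝ}
    (hh : ση⁻¹ * h * ση = dilMat t ∨ ση⁻¹ * h * ση = -dilMat t) :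
    ση⁻¹ * (h⁻¹ * u * h : Γ) * ση = dilMat (-t) * (ση⁻¹ * u * ση) * dilMat t := by
  have e : ση⁻¹ * (h⁻¹ * u * h : Γ) * ση = (ση⁻¹ * h * ση)⁻¹ * (ση⁻¹ * u * ση) * (ση⁻¹ * h * ση) := by
    push_cast; group
  rw [e, dilMat_neg]
  rcases hh with hh | hh
  · rw [hh]
  · have : (-dilMat t)⁻¹ = -(dilMat t)⁻¹ := by
      rw [inv_eq_iff_mul_eq_one, neg_mul_neg, mul_inv_cancel]
    rw [hh, this]
    simp

/-- If an element of the discrete group fixes one of `η₁`, `η₂`, it fixes the other one. -/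
lemma entry_zero_iff (hd : DiscreteTopology Γ) (hη : IsHypPair Γ η) (hση : IsHypScaling η ση)
    (u : Γ) : (ση⁻¹ * u * ση) 0 1 = 0 ↔ (ση⁻¹ * u * ση) 1 0 = 0 := by
  set U := ση⁻¹ * u * ση
  set ℓ := hypLength Γ η ση
  have hℓ : 0 < ℓ := hypLength_pos hd hη hση
  choose h hmem hh using exists_mem_of_int hd hη hση
  -- Conjugation by the j-th dilation keeps the diagonal and scales the off-diagonal entries by
  -- e^{-jℓ} and e^{jℓ}.
  have entries (j : ℤ) : let V := ση⁻¹ * ((h j)⁻¹ * u * h j : Γ) * ση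
      V 0 0 = U 0 0 ∧ V 0 1 = Real.exp (-(j * ℓ)) * U 0 1 ∧ V 1 0 = Real.exp (j * ℓ) * U 1 0 ∧
        V 1 1 = U 1 1 := by
    intro V
    have hV : V = dilMat (-(j * ℓ)) * U * dilMat (j * ℓ) := conj_eq_dilMat_conj (hh j)
    have e1 (x : ℝ) : Real.exp (-x) = Real.exp (-x / 2) * Real.exp (-(x / 2)) := by
      rw [← Real.exp_add]; ring_nf
    have e2 (x : ℝ) : Real.exp x = Real.exp (-(-x / 2)) * Real.exp (x / 2) := by
      rw [← Real.exp_add]; ring_nf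
    have e3 (x : ℝ) : Real.exp (-x / 2) * Real.exp (x / 2) = 1 := by
      rw [← Real.exp_add]; ring_nf; simp
    have e4 (x : ℝ) : Real.exp (-(-x / 2)) * Real.exp (-(x / 2)) = 1 := by
      rw [← Real.exp_add]; ring_nf; simp
    have e1' := e1 (j * ℓ)
    have e2' := e2 (j * ℓ)
    have e3' := e3 (j * ℓ)
    have e4' := e4 (j * ℓ)
    rw [hV]
    simp only [mul_entries, dilMat_00, dilMat_01, dilMat_10, dilMat_11]
    refine ⟨?_, ?_, ?_, ?_⟩
    · linear_combination U 0 0 * e3'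
    · linear_combination -U 0 1 * e1'
    · linear_combination -U 1 0 * e2'
    · linear_combination U 1 1 * e4'
  have fin := finite_bounded Γ hd ση⁻¹ ση (|U 0 0| + |U 0 1| + |U 1 0| + |U 1 1|)
  have hexp (j : ℕ) : Real.exp (-(j * ℓ)) ≤ 1 := Real.exp_le_one_iff.2 (by simpa using by positivity)
  have pos := abs_nonneg (U 0 0)
  have pos' := abs_nonneg (U 0 1)
  have pos'' := abs_nonneg (U 1 0)
  have pos''' := abs_nonneg (U 1 1)
  constructor
  · intro h01
    by_contra h10
    -- With only one nonzero off-diagonal entry, conjugation in the direction that shrinks it yields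
    -- infinitely many distinct elements of Γ in a bounded set.
    refine Set.infinite_of_injective_forall_mem (f := fun j : ℕ => (h (-j))⁻¹ * u * h (-j))
      (fun j j' hjj => ?_) (fun j => ?_) fin
    · have h1 := (entries (-j)).2.2.1
      have h2 := (entries (-j')).2.2.1
      rw [show (h (-j))⁻¹ * u * h (-j) = (h (-j'))⁻¹ * u * h (-j') from hjj, h2] at h1
      have h3 := Real.exp_injective (mul_right_cancel₀ h10 h1)
      have h4 := mul_right_cancel₀ hℓ.ne' h3
      simpa using h4.symm
    · obtain ⟨h1, h2, h3, h4⟩ := entries (-j)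
      have e := hexp j
      intro i k
      fin_cases i <;> fin_cases k <;> simp only [Fin.zero_eta, Fin.mk_one, Fin.isValue, h1, h2, h3,
        h4, h01, mul_zero, abs_zero, abs_mul, Real.abs_exp, Int.cast_neg, Int.cast_natCast,
        neg_mul] <;> nlinarith
  · intro h10
    by_contra h01
    refine Set.infinite_of_injective_forall_mem (f := fun j : ℕ => (h j)⁻¹ * u * h j)
      (fun j j' hjj => ?_) (fun j => ?_) fin
    · have h1 := (entries j).2.1
      have h2 := (entries j').2.1
      rw [show (h j)⁻¹ * u * h j = (h j')⁻¹ * u * h j' from hjj, h2] at h1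
      have h3 := Real.exp_injective (mul_right_cancel₀ h01 h1)
      have h4 := mul_right_cancel₀ hℓ.ne' (neg_injective h3)
      simpa using h4.symm
    · obtain ⟨h1, h2, h3, h4⟩ := entries j
      have e := hexp j
      intro i k
      fin_cases i <;> fin_cases k <;> simp only [Fin.zero_eta, Fin.mk_one, Fin.isValue, h1, h2, h3,
        h4, h10, mul_zero, abs_zero, abs_mul, Real.abs_exp, Int.cast_natCast] <;> nlinarith

variable {𝔞 : OnePoint ℝ} {σa : SL(2, ℝ)}

lemma exists_trans (hσa : IsCuspScaling Γ 𝔞 σa) (t : ℤ) :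
    ∃ τ ∈ fixer Γ 𝔞, σa⁻¹ * τ * σa = transMat t ∨ σa⁻¹ * τ * σa = -transMat t :=
  (hσa.2 (transMat t)).2 ⟨t, Or.inl rfl⟩

lemma conj_transMat_01 (M : SL(2, ℝ)) (t : ℝ) : (M * transMat t * M⁻¹) 0 1 = M 0 0 ^ 2 * t := by
  simp only [mul_entries, transMat_00, transMat_01, transMat_10, transMat_11,
    Matrix.SpecialLinearGroup.coe_inv, Matrix.adjugate_fin_two, Matrix.of_apply,
    Matrix.cons_val', Matrix.cons_val_zero, Matrix.cons_val_one, Matrix.cons_val_fin_one]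
  ring

lemma conj_transMat_10 (M : SL(2, ℝ)) (t : ℝ) : (M * transMat t * M⁻¹) 1 0 = -M 1 0 ^ 2 * t := by
  simp only [mul_entries, transMat_00, transMat_01, transMat_10, transMat_11,
    Matrix.SpecialLinearGroup.coe_inv, Matrix.adjugate_fin_two, Matrix.of_apply,
    Matrix.cons_val', Matrix.cons_val_zero, Matrix.cons_val_one, Matrix.cons_val_fin_one]
  ring

/-- Conjugating a parabolic generator at the cusp by M gives off-diagonal entries ±a² and ∓c². By
`entry_zero_iff` a and c vanish together, which the determinant forbids. -/
lemma prod_ne_zero (hd : DiscreteTopology Γ) (hη : IsHypPair Γ η) (hση : IsHypScaling η ση)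
    (hσa : IsCuspScaling Γ 𝔞 σa) (γ : Γ) :
    (ση⁻¹ * γ * σa) 0 0 * (ση⁻¹ * γ * σa) 1 0 ≠ 0 := by
  obtain ⟨p, -, hp⟩ := exists_trans hσa 1
  set M := ση⁻¹ * γ * σa
  have hU : ση⁻¹ * (γ * p * γ⁻¹ : Γ) * ση = M * (σa⁻¹ * p * σa) * M⁻¹ := by
    simp only [M]; push_cast; group
  have hiff := entry_zero_iff hd hη hση (γ * p * γ⁻¹)
  have h2 : M 0 0 = 0 ↔ M 1 0 = 0 := by
    rw [hU] at hiff
    rcases hp with hp | hp <;> rw [hp] at hiff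
    · simpa [conj_transMat_01, conj_transMat_10] using hiff
    · simpa [conj_transMat_01, conj_transMat_10, neg_entries] using hiff
  have hdet := det_entries M
  intro h0
  rcases mul_eq_zero.1 h0 with h | h
  · simp [h, h2.1 h] at hdet
  · simp [h, h2.2 h] at hdet

/-! ### Decomposition of the cosets along double cosets -/

variable (Γ 𝔞 σa) in
/-- A choice of elements of `Γ_𝔞` inducing the translations by integers. -/
structure TransSection where
  /-- The element inducing the translation. -/
  elt : ℤ → Γ
  mem : ∀ t, elt t ∈ fixer Γ 𝔞
  conj : ∀ t, σa⁻¹ * elt t * σa = transMat t ∨ σa⁻¹ * elt t * σa = -transMat t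

lemma exists_transSection (hσa : IsCuspScaling Γ 𝔞 σa) : Nonempty (TransSection Γ 𝔞 σa) := by
  choose τ h1 h2 using exists_trans hσa
  exact ⟨⟨τ, h1, h2⟩⟩

/-- The coset `Γ_η γ τ_t`, where `γ` represents a given double coset. -/
def cosetOf (τ : TransSection Γ 𝔞 σa) (p : HypParDoubleCosets Γ η 𝔞 × ℤ) : HypCosets Γ η :=
  Quotient.mk _ (Quotient.out p.1 * τ.elt p.2)

/-- Two translates of one representative lie in the same coset only if a²(t' - t) = 0, and a ≠ 0.
Conversely Γ_𝔞 consists, up to sign, of integer translations, and signs are absorbed by Γ_η. -/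
lemma cosetOf_bijective (hd : DiscreteTopology Γ) (hη : IsHypPair Γ η) (hση : IsHypScaling η ση)
    (hσa : IsCuspScaling Γ 𝔞 σa) (τ : TransSection Γ 𝔞 σa) :
    Function.Bijective (cosetOf (η := η) τ) := by
  constructor
  · rintro ⟨Q, t⟩ ⟨Q', t'⟩ h
    rw [cosetOf, cosetOf, mk_eq_mk_iff] at h
    have hQ : Q = Q' := by
      rw [← DoubleCoset.out_eq' (pairFixer Γ η) (fixer Γ 𝔞) Q,
        ← DoubleCoset.out_eq' (pairFixer Γ η) (fixer Γ 𝔞) Q', DoubleCoset.eq]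
      refine ⟨_, h, τ.elt t * (τ.elt t')⁻¹, mul_mem (τ.mem t) (inv_mem (τ.mem t')), ?_⟩
      group
    subst hQ
    obtain ⟨h01, -⟩ := (mem_pairFixer_iff hση _).1 h
    set M := ση⁻¹ * (Quotient.out Q : Γ) * σa with hM
    have e : ση⁻¹ * (Quotient.out Q * τ.elt t' * (Quotient.out Q * τ.elt t)⁻¹ : Γ) * ση =
        M * ((σa⁻¹ * τ.elt t' * σa) * (σa⁻¹ * τ.elt t * σa)⁻¹) * M⁻¹ := by
      rw [hM]; push_cast; group
    have e2 : M * transMat (t' - t) * M⁻¹ = M * (transMat t' * (transMat t)⁻¹) * M⁻¹ := by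
      rw [sub_eq_add_neg, transMat_add, transMat_neg]
    have hneg (A : SL(2, ℝ)) : (-A)⁻¹ = -A⁻¹ := by
      rw [inv_eq_iff_mul_eq_one, neg_mul_neg, mul_inv_cancel]
    have h01' : (M * transMat (t' - t) * M⁻¹) 0 1 = 0 := by
      rw [e] at h01
      rw [e2]
      rcases τ.conj t with h1 | h1 <;> rcases τ.conj t' with h2 | h2 <;> rw [h1, h2] at h01 <;>
        simpa [hneg, neg_entries] using h01
    rw [conj_transMat_01, mul_eq_zero] at h01'
    have ha := left_ne_zero_of_mul (prod_ne_zero hd hη hση hσa (Quotient.out Q))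
    have ht : (t' : ℝ) - t = 0 := h01'.resolve_left (pow_ne_zero 2 ha)
    have ht' : t' = t := by exact_mod_cast sub_eq_zero.1 ht
    rw [ht']
  · intro q
    obtain ⟨γ, rfl⟩ := Quotient.exists_rep q
    obtain ⟨h, κ, hh, hκ, hout⟩ := DoubleCoset.mk_out_eq_mul (pairFixer Γ η) (fixer Γ 𝔞) γ
    -- The translation must undo κ, so that κ τ_t = ±I.
    obtain ⟨t, ht⟩ := (hσa.2 (σa⁻¹ * (κ⁻¹ : Γ) * σa)).1 ⟨κ⁻¹, inv_mem hκ, Or.inl rfl⟩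
    refine ⟨(DoubleCoset.mk (pairFixer Γ η) (fixer Γ 𝔞) γ, t), ?_⟩
    rw [cosetOf, mk_eq_mk_iff]
    have hout' : (Quotient.out (DoubleCoset.mk (pairFixer Γ η) (fixer Γ 𝔞) γ) : Γ) = h * γ * κ :=
      hout
    simp only [hout']
    have hε : ((κ * τ.elt t : Γ) : SL(2, ℝ)) = 1 ∨ ((κ * τ.elt t : Γ) : SL(2, ℝ)) = -1 := by
      have e1 : ((κ * τ.elt t : Γ) : SL(2, ℝ)) =
          σa * ((σa⁻¹ * (κ⁻¹ : Γ) * σa)⁻¹ * (σa⁻¹ * τ.elt t * σa)) * σa⁻¹ := by push_cast; group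
      have hneg (A : SL(2, ℝ)) : (-A)⁻¹ = -A⁻¹ := by
        rw [inv_eq_iff_mul_eq_one, neg_mul_neg, mul_inv_cancel]
      rw [e1]
      rcases ht with ht | ht <;> rcases τ.conj t with h2 | h2 <;> rw [ht, h2] <;> simp [hneg]
    have e3 : γ * (h * γ * κ * τ.elt t)⁻¹ = γ * (κ * τ.elt t)⁻¹ * γ⁻¹ * h⁻¹ := by group
    rw [e3]
    refine mul_mem ?_ (inv_mem hh)
    rw [mem_pairFixer_iff hση]
    have e4 : ση⁻¹ * (γ * (κ * τ.elt t)⁻¹ * γ⁻¹ : Γ) * ση =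
        ση⁻¹ * γ * ((κ * τ.elt t : Γ) : SL(2, ℝ))⁻¹ * (γ : SL(2, ℝ))⁻¹ * ση := by push_cast; group
    rw [e4]
    have hneg1 : (-1 : SL(2, ℝ))⁻¹ = -1 := by rw [inv_eq_iff_mul_eq_one]; simp
    rcases hε with hε | hε <;> rw [hε]
    · simp
    · simp [hneg1, neg_entries]

/-- The cosets in `Γ_η \ Γ` are parametrized by a double coset in `Γ_η \ Γ / Γ_𝔞` and an integral
translation. -/
def cosetEquiv (hd : DiscreteTopology Γ) (hη : IsHypPair Γ η) (hση : IsHypScaling η ση)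
    (hσa : IsCuspScaling Γ 𝔞 σa) (τ : TransSection Γ 𝔞 σa) :
    HypParDoubleCosets Γ η 𝔞 × ℤ ≃ HypCosets Γ η :=
  Equiv.ofBijective _ (cosetOf_bijective hd hη hση hσa τ)

/-- A left `Γ_η`-invariant even function of `ση⁻¹ γ σ_𝔞`, evaluated along the decomposition. -/
lemma apply_cosetEquiv_out {α : Type*} (hd : DiscreteTopology Γ) (hη : IsHypPair Γ η)
    (hση : IsHypScaling η ση) (hσa : IsCuspScaling Γ 𝔞 σa) (τ : TransSection Γ 𝔞 σa)
    (f : SL(2, ℝ) → α) (hneg : ∀ M, f (-M) = f M)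
    (hf : ∀ h ∈ pairFixer Γ η, ∀ γ : Γ, f (ση⁻¹ * (h * γ : Γ) * σa) = f (ση⁻¹ * γ * σa))
    (Q : HypParDoubleCosets Γ η 𝔞) (t : ℤ) :
    f (ση⁻¹ * ((cosetEquiv hd hη hση hσa τ (Q, t)).out : Γ) * σa) =
      f (ση⁻¹ * (Quotient.out Q : Γ) * σa * transMat t) := by
  have h1 := apply_out_mk (η := η) (fun γ : Γ => f (ση⁻¹ * γ * σa)) hf
    (Quotient.out Q * τ.elt t)
  have h2 : cosetEquiv hd hη hση hσa τ (Q, t) = Quotient.mk _ (Quotient.out Q * τ.elt t) := rfl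
  rw [h2, h1]
  have e : ση⁻¹ * (Quotient.out Q * τ.elt t : Γ) * σa =
      ση⁻¹ * (Quotient.out Q : Γ) * σa * (σa⁻¹ * τ.elt t * σa) := by push_cast; group
  simp only [e]
  rcases τ.conj t with h | h <;> rw [h]
  rw [mul_neg, hneg]

theorem summable_wt_doubleCosets (hd : DiscreteTopology Γ) (hη : IsHypPair Γ η)
    (hση : IsHypScaling η ση) (hσa : IsCuspScaling Γ 𝔞 σa) :
    Summable fun p : HypParDoubleCosets Γ η 𝔞 × ℤ =>
      wt (ση⁻¹ * (Quotient.out p.1 : Γ) * σa * transMat p.2) := by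
  obtain ⟨τ⟩ := exists_transSection hσa
  refine ((cosetEquiv hd hη hση hσa τ).summable_iff.2 (summable_wt hd hη hση σa)).congr
    fun p => ?_
  exact (apply_cosetEquiv_out hd hη hση hσa τ wt wt_neg
    (fun h hh γ => wt_mul_of_mem hση σa hh γ) p.1 p.2)

/-- Each double coset with ac = C has a translate whose weight is bounded below in terms of C alone,
and a summable family has only finitely many such members. -/
theorem finite_doubleCosetsAt (hd : DiscreteTopology Γ) (hη : IsHypPair Γ η)
    (hση : IsHypScaling η ση) (hσa : IsCuspScaling Γ 𝔞 σa) (C : ℝ) :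
    (doubleCosetsAt Γ η ση 𝔞 σa C).Finite := by
  have hs := summable_wt_doubleCosets hd hη hση hσa
  set ε : ℝ := 1 / (1 + (2 * |C| + 1) ^ 2) with hε
  have hε0 : 0 < ε := by positivity
  have hfin : {p : HypParDoubleCosets Γ η 𝔞 × ℤ |
      ε ≤ wt (ση⁻¹ * (Quotient.out p.1 : Γ) * σa * transMat p.2)}.Finite := by
    have := hs.tendsto_cofinite_zero.eventually (gt_mem_nhds hε0)
    rw [Filter.eventually_cofinite] at this
    simpa using this
  refine (hfin.image Prod.fst).subset fun Q hQ => ?_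
  set M := ση⁻¹ * (Quotient.out Q : Γ) * σa
  have hac : M 0 0 * M 1 0 = C := hQ
  have ha : M 0 0 ≠ 0 := left_ne_zero_of_mul (prod_ne_zero hd hη hση hσa (Quotient.out Q))
  -- This translation reduces b/a to its fractional part f, and then ac + bd = C + Cf² + f.
  refine ⟨(Q, -⌊M 0 1 / M 0 0⌋), ?_, rfl⟩
  change ε ≤ wt (M * transMat (-⌊M 0 1 / M 0 0⌋ : ℤ))
  set f := Int.fract (M 0 1 / M 0 0) with hf
  have hcross : crossTerm (M * transMat (-⌊M 0 1 / M 0 0⌋ : ℤ)) = C + (C * f ^ 2 + f) := by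
    have hfl : (⌊M 0 1 / M 0 0⌋ : ℝ) = M 0 1 / M 0 0 - f := by
      rw [hf, Int.fract]; ring
    have hdet := det_entries M
    have h11 : M 1 1 = (1 + M 0 1 * M 1 0) / M 0 0 := by field_simp; linarith
    simp only [crossTerm, mul_entries, transMat_00, transMat_01, transMat_10, transMat_11,
      Int.cast_neg, hfl, ← hac, h11]
    field_simp
    ring
  rw [wt, topSq_mul_botSq, hcross, hε]
  have h0 := Int.fract_nonneg (M 0 1 / M 0 0)
  have h1 := (Int.fract_lt_one (M 0 1 / M 0 0)).le
  rw [← hf] at h0 h1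
  have hC := abs_nonneg C
  have habs : |C + (C * f ^ 2 + f)| ≤ |2 * |C| + 1| := by
    rw [abs_of_nonneg (show 0 ≤ 2 * |C| + 1 by positivity)]
    have hf2 : f ^ 2 ≤ 1 := by nlinarith
    calc |C + (C * f ^ 2 + f)| ≤ |C| + (|C * f ^ 2| + |f|) :=
          (abs_add_le _ _).trans (add_le_add le_rfl (abs_add_le _ _))
      _ = |C| + (|C| * f ^ 2 + f) := by
          rw [abs_mul, abs_of_nonneg h0, abs_of_nonneg (sq_nonneg f)]
      _ ≤ _ := by nlinarith
  exact one_div_le_one_div_of_le (by positivity) (by linarith [sq_le_sq.2 habs])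

end

/-! ### Fourier expansion of periodic holomorphic functions on the upper half-plane -/

/-- The `n`-th Fourier coefficient of `F`, computed at height `y`. -/
def lineCoeff (F : ℂ → ℂ) (n : ℤ) (y : ℝ) : ℂ :=
  ∫ x in (0 : ℝ)..1, F (x + y * I) * exp (-2 * Real.pi * I * n * (x + y * I))

lemma exp_neg_two_pi_add_one (n : ℤ) (z : ℂ) :
    exp (-2 * Real.pi * I * n * (z + 1)) = exp (-2 * Real.pi * I * n * z) := by
  rw [mul_add, mul_one, exp_add]
  have : exp (-2 * Real.pi * I * n) = 1 := by
    rw [exp_eq_one_iff]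
    exact ⟨-n, by push_cast; ring⟩
  rw [this, mul_one]

/-- Cauchy's theorem on a rectangle of width one; the vertical sides cancel by periodicity. -/
lemma lineCoeff_eq {F : ℂ → ℂ} (hF : DifferentiableOn ℂ F {z | 0 < z.im})
    (hper : ∀ z : ℂ, 0 < z.im → F (z + 1) = F z) (n : ℤ) {y y' : ℝ} (hy : 0 < y) (hy' : 0 < y') :
    lineCoeff F n y = lineCoeff F n y' := by
  set G : ℂ → ℂ := fun z => F z * exp (-2 * Real.pi * I * n * z) with hG
  have hGd : DifferentiableOn ℂ G {z | 0 < z.im} := hF.mul (by fun_prop)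
  have hGper : ∀ z : ℂ, 0 < z.im → G (z + 1) = G z := by
    intro z hz
    simp only [hG, hper z hz, exp_neg_two_pi_add_one]
  have h := integral_boundary_rect_eq_zero_of_differentiableOn G (y * I) (1 + y' * I)
    (hGd.mono fun z hz => by
      rw [mem_reProdIm] at hz
      simp only [mul_im, ofReal_re, I_im, mul_one, ofReal_im, I_re, mul_zero, add_zero, add_im,
        one_im, zero_add] at hz
      exact (lt_min hy hy').trans_le hz.2.1)
  simp only [mul_re, ofReal_re, I_re, mul_zero, ofReal_im, I_im, mul_one, sub_self, add_re, one_re,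
    add_zero, mul_im, add_im, one_im, zero_add, ofReal_zero, ofReal_one] at h
  have hvert : ∫ t in y..y', G (1 + t * I) = ∫ t in y..y', G (t * I) := by
    refine intervalIntegral.integral_congr fun t ht => ?_
    have ht0 : 0 < t := (lt_min hy hy').trans_le ht.1
    rw [add_comm, hGper _ (by simpa using ht0)]
  rw [hvert, add_sub_assoc, sub_self, add_zero, sub_eq_zero] at h
  exact h

lemma differentiableOn_continuous_line {F : ℂ → ℂ} (hF : DifferentiableOn ℂ F {z | 0 < z.im})
    {y : ℝ} (hy : 0 < y) : Continuous fun x : ℝ => F (x + y * I) := by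
  rw [continuous_iff_continuousAt]
  intro x
  have hopen : IsOpen {z : ℂ | 0 < z.im} := isOpen_lt continuous_const continuous_im
  have h1 : ContinuousAt F (x + y * I) :=
    (hF.continuousOn.continuousAt (hopen.mem_nhds (by simpa using hy)))
  exact h1.comp (f := fun x : ℝ => (x : ℂ) + y * I) (by fun_prop)

lemma norm_exp_fourier (n : ℤ) (x y : ℝ) :
    ‖exp (2 * Real.pi * I * n * (x + y * I))‖ = Real.exp (-2 * Real.pi * n * y) := by
  rw [norm_exp]
  congr 1
  simp [mul_re, mul_im]

lemma norm_exp_neg_fourier (n : ℤ) (x y : ℝ) :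
    ‖exp (-2 * Real.pi * I * n * (x + y * I))‖ = Real.exp (2 * Real.pi * n * y) := by
  rw [norm_exp]
  congr 1
  simp [mul_re, mul_im]

lemma exists_norm_lineCoeff_le {F : ℂ → ℂ} (hF : DifferentiableOn ℂ F {z | 0 < z.im})
    {y : ℝ} (hy : 0 < y) :
    ∃ B : ℝ, ∀ n : ℤ, ‖lineCoeff F n y‖ ≤ B * Real.exp (2 * Real.pi * n * y) := by
  obtain ⟨B, hB⟩ := (isCompact_uIcc (a := (0 : ℝ)) (b := 1)).exists_bound_of_continuousOn
    (differentiableOn_continuous_line hF hy).continuousOn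
  refine ⟨B, fun n => ?_⟩
  have := intervalIntegral.norm_integral_le_of_norm_le_const (a := (0 : ℝ)) (b := 1)
    (f := fun x : ℝ => F (x + y * I) * exp (-2 * Real.pi * I * n * (x + y * I)))
    (C := B * Real.exp (2 * Real.pi * n * y)) fun x hx => by
      rw [norm_mul, norm_exp_neg_fourier]
      exact mul_le_mul_of_nonneg_right (hB x (Set.uIoc_subset_uIcc hx)) (Real.exp_pos _).le
  simpa [lineCoeff] using this

lemma summable_int_exp {a : ℝ} (ha : 0 < a) : Summable fun n : ℤ => Real.exp (-a * |(n : ℝ)|) := by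
  have h : Summable fun n : ℕ => Real.exp (-a * n) := by
    have := Real.summable_exp_nat_mul_iff.2 (neg_lt_zero.2 ha)
    simpa [mul_comm] using this
  refine Summable.of_nat_of_neg ?_ ?_ <;> simpa using h

/-- Since the coefficients do not depend on the height, evaluating them at y/2 for n ≥ 0 and at 2y
for n ≤ 0 gives exponential decay in |n|. -/
lemma summable_coeff {F : ℂ → ℂ} (hF : DifferentiableOn ℂ F {z | 0 < z.im})
    (hper : ∀ z : ℂ, 0 < z.im → F (z + 1) = F z) {y : ℝ} (hy : 0 < y) :
    Summable fun n : ℤ => ‖lineCoeff F n y‖ * Real.exp (-2 * Real.pi * n * y) := by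
  obtain ⟨B, hB⟩ := exists_norm_lineCoeff_le hF (show 0 < y / 2 by positivity)
  obtain ⟨B', hB'⟩ := exists_norm_lineCoeff_le hF (show 0 < 2 * y by positivity)
  have hpi := Real.pi_pos
  refine Summable.of_nonneg_of_le (fun n => by positivity) (fun n => ?_)
    ((summable_int_exp (show 0 < Real.pi * y by positivity)).mul_left (max |B| |B'|))
  rcases le_total 0 (n : ℝ) with hn | hn
  · rw [lineCoeff_eq hF hper n hy (show 0 < y / 2 by positivity)]
    refine (mul_le_mul_of_nonneg_right (hB n) (Real.exp_pos _).le).trans ?_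
    rw [mul_assoc, ← Real.exp_add]
    refine mul_le_mul ((le_abs_self B).trans (le_max_left _ _)) (Real.exp_le_exp.2 ?_)
      (Real.exp_pos _).le (by positivity)
    rw [abs_of_nonneg hn]
    linarith
  · rw [lineCoeff_eq hF hper n hy (show 0 < 2 * y by positivity)]
    refine (mul_le_mul_of_nonneg_right (hB' n) (Real.exp_pos _).le).trans ?_
    rw [mul_assoc, ← Real.exp_add]
    refine mul_le_mul ((le_abs_self B').trans (le_max_right _ _)) (Real.exp_le_exp.2 ?_)
      (Real.exp_pos _).le (by positivity)
    rw [abs_of_nonpos hn]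
    have : 0 ≤ Real.pi * y * (-n) := mul_nonneg (by positivity) (by linarith)
    linarith

lemma hasSum_lineCoeff {F : ℂ → ℂ} (hF : DifferentiableOn ℂ F {z | 0 < z.im})
    (hper : ∀ z : ℂ, 0 < z.im → F (z + 1) = F z) (x : ℝ) {y : ℝ} (hy : 0 < y) :
    HasSum (fun n : ℤ => lineCoeff F n y * exp (2 * Real.pi * I * n * (x + y * I)))
      (F (x + y * I)) := by
  have hp : Function.Periodic (fun x : ℝ => F (x + y * I)) (1 : ℝ) := by
    intro x
    simp only
    rw [← hper (x + y * I) (by simpa using hy)]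
    congr 1
    push_cast
    ring
  have : Fact ((0 : ℝ) < 1) := ⟨one_pos⟩
  have hcont := differentiableOn_continuous_line hF hy
  let f : C(AddCircle (1 : ℝ), ℂ) := ⟨hp.lift, by
    exact continuous_coinduced_dom.2 hcont⟩
  have hfx (x : ℝ) : f (x : AddCircle (1 : ℝ)) = F (x + y * I) := rfl
  have hcoef (n : ℤ) : fourierCoeff f n = lineCoeff F n y * exp (2 * Real.pi * I * n * (y * I)) := by
    rw [fourierCoeff_eq_intervalIntegral f n 0, lineCoeff, ← intervalIntegral.integral_mul_const]
    simp only [zero_add, one_div, inv_one, one_smul]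
    refine intervalIntegral.integral_congr fun x _ => ?_
    simp only [hfx, smul_eq_mul]
    rw [fourier_coe_apply, mul_comm, mul_assoc (F _), ← exp_add]
    congr 2
    push_cast
    ring
  have hsum : Summable (fourierCoeff f) := by
    refine Summable.of_norm ((summable_coeff hF hper hy).congr fun n => ?_)
    rw [hcoef, norm_mul]
    congr 1
    simpa using (norm_exp_fourier n 0 y).symm
  have h := has_pointwise_sum_fourier_series_of_summable hsum x
  rw [hfx] at h
  convert h using 2 with n
  rw [hcoef, smul_eq_mul, fourier_coe_apply, mul_assoc (lineCoeff F n y), ← exp_add]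
  congr 2
  push_cast
  ring

/-- Summability at x = 0 is absolute and the norms of the terms do not depend on x, so integration
term by term is allowed and orthogonality isolates one coefficient. -/
lemma lineCoeff_of_hasSum {F : ℂ → ℂ} {c : ℤ → ℂ} {y : ℝ}
    (hc : ∀ x : ℝ, HasSum (fun n : ℤ => c n * exp (2 * Real.pi * I * n * (x + y * I)))
      (F (x + y * I))) (n : ℤ) : c n = lineCoeff F n y := by
  have hs : Summable fun n : ℤ => ‖c n‖ * Real.exp (-2 * Real.pi * n * y) := by
    refine (hc 0).summable.norm.congr fun n => ?_
    rw [norm_mul, norm_exp_fourier]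
  have h := intervalIntegral.hasSum_integral_of_dominated_convergence (μ := volume)
    (a := (0 : ℝ)) (b := 1)
    (F := fun (j : ℤ) (x : ℝ) => c j * exp (2 * Real.pi * I * j * (x + y * I)) *
      exp (-2 * Real.pi * I * n * (x + y * I)))
    (f := fun x : ℝ => F (x + y * I) * exp (-2 * Real.pi * I * n * (x + y * I)))
    (fun j _ => ‖c j‖ * Real.exp (-2 * Real.pi * j * y) * Real.exp (2 * Real.pi * n * y))
    (fun j => by
      refine Continuous.aestronglyMeasurable ?_
      fun_prop)
    (fun j => Filter.Eventually.of_forall fun x _ => by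
      rw [norm_mul, norm_mul, norm_exp_fourier, norm_exp_neg_fourier])
    (Filter.Eventually.of_forall fun x _ => hs.mul_right _)
    (by simp)
    (Filter.Eventually.of_forall fun x _ => (hc x).mul_right _)
  have hterm (j : ℤ) : (∫ x in (0 : ℝ)..1, c j * exp (2 * Real.pi * I * j * (x + y * I)) *
      exp (-2 * Real.pi * I * n * (x + y * I))) = if j = n then c n else 0 := by
    split_ifs with hj
    · subst hj
      have : ∀ x : ℝ, c j * exp (2 * Real.pi * I * j * (x + y * I)) *
          exp (-2 * Real.pi * I * j * (x + y * I)) = c j := fun x => by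
        rw [mul_assoc, ← exp_add]
        ring_nf
        simp
      simp only [this, intervalIntegral.integral_const, sub_zero, one_smul]
    · have hne : (2 * Real.pi * I * (j - n) : ℂ) ≠ 0 := by
        refine mul_ne_zero two_pi_I_ne_zero ?_
        exact_mod_cast sub_ne_zero.2 hj
      have : ∀ x : ℝ, c j * exp (2 * Real.pi * I * j * (x + y * I)) *
          exp (-2 * Real.pi * I * n * (x + y * I)) =
          c j * exp (2 * Real.pi * I * (j - n) * (y * I)) *
            exp ((2 * Real.pi * I * (j - n)) * x) := fun x => by
        rw [mul_assoc (c j), ← exp_add, mul_assoc (c j), ← exp_add]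
        ring_nf
      simp only [this]
      rw [intervalIntegral.integral_const_mul, integral_exp_mul_complex hne]
      have h1 : exp (2 * Real.pi * I * (j - n) * (1 : ℝ)) = 1 := by
        rw [exp_eq_one_iff]
        exact ⟨j - n, by push_cast; ring⟩
      rw [h1]
      simp
  simp only [hterm] at h
  have h2 : HasSum (fun j : ℤ => if j = n then c n else 0) (c n) := hasSum_ite_eq n (c n)
  exact h2.unique h

/-- A `1`-periodic holomorphic function on the upper half-plane has a unique Fourier expansion,
whose coefficients can be computed at any height. -/
theorem hasSum_fourier_iff {F : ℂ → ℂ} (hF : DifferentiableOn ℂ F {z | 0 < z.im})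
    (hper : ∀ z : ℂ, 0 < z.im → F (z + 1) = F z) {y : ℝ} (hy : 0 < y) (c : ℤ → ℂ) :
    (∀ z : ℍ, HasSum (fun n : ℤ => c n * exp (2 * Real.pi * I * n * z)) (F z)) ↔
      ∀ n, c n = lineCoeff F n y := by
  constructor
  · intro h n
    refine lineCoeff_of_hasSum (fun x => ?_) n
    have := h ⟨x + y * I, by simpa using hy⟩
    exact this
  · intro h z
    have := hasSum_lineCoeff hF hper z.re z.im_pos
    have hz : (z.re : ℂ) + z.im * I = z := re_add_im (z : ℂ)
    rw [hz] at this
    convert this using 3 with n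
    rw [h n, lineCoeff_eq hF hper n hy z.im_pos]

/-! ### The terms of the series -/

/-- The function `z ^ (-κ + 2πim/l) |_{2κ} M`, with the integral power separated off. -/
def seriesTerm (κ : ℕ) (l : ℝ) (m : ℤ) (M : SL(2, ℝ)) (z : ℂ) : ℂ :=
  ((M 0 0 * z + M 0 1) / (M 1 0 * z + M 1 1)) ^ (2 * Real.pi * I * m / l) /
    ((M 0 0 * z + M 0 1) * (M 1 0 * z + M 1 1)) ^ κ

/-- The constant in the lower bound for `|az + b|` on `{|re z| ≤ A, im z ≥ δ}`. -/
def lowerConst (A δ : ℝ) : ℝ := (2 + (2 * A ^ 2 + 1) / δ ^ 2)⁻¹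

lemma lowerConst_pos {δ : ℝ} (A : ℝ) (hδ : 0 < δ) : 0 < lowerConst A δ := by
  unfold lowerConst; positivity

/-- The imaginary part gives a²δ² ≤ |az+b|², and b = Re(az+b) - a Re z then controls b². -/
lemma le_norm_sq_linear {A δ : ℝ} (hδ : 0 < δ) (a b : ℝ) {z : ℂ} (hA : |z.re| ≤ A)
    (hz : δ ≤ z.im) : lowerConst A δ * (a ^ 2 + b ^ 2) ≤ ‖(a * z + b : ℂ)‖ ^ 2 := by
  rw [Complex.sq_norm, Complex.normSq_apply]
  simp only [add_re, mul_re, ofReal_re, ofReal_im, zero_mul, sub_zero, add_im, mul_im, add_zero]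
  rw [lowerConst, inv_mul_le_iff₀ (by positivity)]
  have h1 : z.re ^ 2 ≤ A ^ 2 := sq_le_sq' (abs_le.1 hA).1 (abs_le.1 hA).2
  have h2 : δ ^ 2 ≤ z.im ^ 2 := by gcongr
  have h3 : a ^ 2 * (2 * A ^ 2 + 1) ≤
      (2 * A ^ 2 + 1) / δ ^ 2 * ((a * z.re + b) * (a * z.re + b) + a * z.im * (a * z.im)) := by
    rw [div_mul_eq_mul_div, le_div_iff₀ (by positivity)]
    have : a ^ 2 * δ ^ 2 ≤ a ^ 2 * z.im ^ 2 := by gcongr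
    have h4 : a ^ 2 * δ ^ 2 ≤ (a * z.re + b) * (a * z.re + b) + a * z.im * (a * z.im) := by
      nlinarith [sq_nonneg (a * z.re + b)]
    nlinarith [mul_le_mul_of_nonneg_left h4 (show 0 ≤ 2 * A ^ 2 + 1 by positivity)]
  have h5 : a ^ 2 * z.re ^ 2 ≤ a ^ 2 * A ^ 2 := by gcongr
  nlinarith [sq_nonneg (a * z.re + b + a * z.re), sq_nonneg (a * z.im)]

lemma top_ne_zero (M : SL(2, ℝ)) {z : ℂ} (hz : 0 < z.im) : (M 0 0 * z + M 0 1 : ℂ) ≠ 0 := by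
  intro h
  have := le_norm_sq_linear hz (M 0 0) (M 0 1) le_rfl le_rfl
  rw [h, norm_zero, zero_pow two_ne_zero] at this
  have h2 := mul_pos (lowerConst_pos |z.re| hz) (topSq_pos M)
  rw [topSq] at h2
  linarith

lemma bot_ne_zero (M : SL(2, ℝ)) {z : ℂ} (hz : 0 < z.im) : (M 1 0 * z + M 1 1 : ℂ) ≠ 0 := by
  intro h
  have := le_norm_sq_linear hz (M 1 0) (M 1 1) le_rfl le_rfl
  rw [h, norm_zero, zero_pow two_ne_zero] at this
  have h2 := mul_pos (lowerConst_pos |z.re| hz) (botSq_pos M)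
  rw [botSq] at h2
  linarith

lemma im_moebius_pos (M : SL(2, ℝ)) {z : ℂ} (hz : 0 < z.im) :
    0 < ((M 0 0 * z + M 0 1) / (M 1 0 * z + M 1 1) : ℂ).im := by
  have h := (M • (⟨z, hz⟩ : ℍ)).im_pos
  rw [← UpperHalfPlane.coe_im, UpperHalfPlane.coe_specialLinearGroup_apply] at h
  exact h

lemma slash_eq_seriesTerm {k : ℤ} {κ : ℕ} (hk : k = 2 * κ) (l : ℝ) (m : ℤ) (M : SL(2, ℝ)) (z : ℍ) :
    slash k (fun z => (z : ℂ) ^ (-(k : ℂ) / 2 + 2 * Real.pi * I * m / l)) M z =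
      seriesTerm κ l m M z := by
  have ht := top_ne_zero M z.im_pos
  have hb := bot_ne_zero M z.im_pos
  have hcoe : ((M • z : ℍ) : ℂ) = (M 0 0 * z + M 0 1) / (M 1 0 * z + M 1 1) := by
    rw [UpperHalfPlane.coe_specialLinearGroup_apply]
    rfl
  have hw : ((M 0 0 * z + M 0 1) / (M 1 0 * z + M 1 1) : ℂ) ≠ 0 := div_ne_zero ht hb
  have hexp : -(k : ℂ) / 2 = -(κ : ℂ) := by rw [hk]; push_cast; ring
  have hzpow : ((M 1 0 : ℂ) * z + M 1 1) ^ (-k) = (((M 1 0 : ℂ) * z + M 1 1) ^ (2 * κ))⁻¹ := by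
    rw [hk, zpow_neg]
    norm_cast
  rw [slash_apply, hcoe, hexp, cpow_add _ _ hw, cpow_neg, cpow_natCast, hzpow, seriesTerm]
  generalize ((M 0 0 * z + M 0 1) / (M 1 0 * z + M 1 1) : ℂ) ^ (2 * Real.pi * I * m / l) = W
  rw [div_pow, mul_pow, pow_mul', sq]
  field_simp

lemma seriesTerm_neg (κ : ℕ) (l : ℝ) (m : ℤ) (M : SL(2, ℝ)) :
    seriesTerm κ l m (-M) = seriesTerm κ l m M := by
  funext z
  have h1 : ((-M) 0 0 * z + (-M) 0 1 : ℂ) = -(M 0 0 * z + M 0 1) := by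
    simp only [neg_entries]; push_cast; ring
  have h2 : ((-M) 1 0 * z + (-M) 1 1 : ℂ) = -(M 1 0 * z + M 1 1) := by
    simp only [neg_entries]; push_cast; ring
  rw [seriesTerm, seriesTerm, h1, h2, neg_div_neg_eq, neg_mul_neg]

lemma ofReal_mul_cpow {ρ : ℝ} (hρ : 0 < ρ) {w : ℂ} (hw : w ≠ 0) (s : ℂ) :
    ((ρ : ℂ) * w) ^ s = exp (Real.log ρ * s) * w ^ s := by
  rw [cpow_def_of_ne_zero (mul_ne_zero (by exact_mod_cast hρ.ne') hw), cpow_def_of_ne_zero hw,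
    log_ofReal_mul hρ hw, add_mul, exp_add]

/-- A dilation multiplies w by e^{jl} > 0, which leaves the argument unchanged, so the power only
gains exp(2πijm) = 1. -/
lemma seriesTerm_dilMat_mul (κ : ℕ) {l : ℝ} (hl : l ≠ 0) (m j : ℤ) (M : SL(2, ℝ)) {z : ℂ}
    (hz : 0 < z.im) : seriesTerm κ l m (dilMat (j * l) * M) z = seriesTerm κ l m M z := by
  have ht := top_ne_zero M hz
  have hb := bot_ne_zero M hz
  have h1 : ((dilMat (j * l) * M) 0 0 * z + (dilMat (j * l) * M) 0 1 : ℂ) =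
      Real.exp (j * l / 2) * (M 0 0 * z + M 0 1) := by
    simp only [mul_entries, dilMat_00, dilMat_01]; push_cast; ring
  have h2 : ((dilMat (j * l) * M) 1 0 * z + (dilMat (j * l) * M) 1 1 : ℂ) =
      Real.exp (-(j * l / 2)) * (M 1 0 * z + M 1 1) := by
    simp only [mul_entries, dilMat_10, dilMat_11]; push_cast; ring
  have h3 : ((Real.exp (j * l / 2) : ℝ) : ℂ) * (Real.exp (-(j * l / 2)) : ℝ) = 1 := by
    rw [← ofReal_mul, ← Real.exp_add, add_neg_cancel, Real.exp_zero, ofReal_one]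
  have h4 : (Real.exp (j * l / 2) * (M 0 0 * z + M 0 1) : ℂ) /
      (Real.exp (-(j * l / 2)) * (M 1 0 * z + M 1 1)) =
      (Real.exp (j * l) : ℝ) * ((M 0 0 * z + M 0 1) / (M 1 0 * z + M 1 1)) := by
    have : ((Real.exp (j * l) : ℝ) : ℂ) = Real.exp (j * l / 2) * Real.exp (j * l / 2) := by
      rw [← ofReal_mul, ← Real.exp_add, add_halves]
    have hne : ((Real.exp (-(j * l / 2)) : ℝ) : ℂ) ≠ 0 := by
      exact_mod_cast (Real.exp_pos _).ne'
    rw [this, mul_div_mul_comm]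
    congr 1
    rw [div_eq_iff hne]
    linear_combination -((Real.exp (j * l / 2) : ℝ) : ℂ) * h3
  have h5 : exp (((j * l : ℝ) : ℂ) * (2 * Real.pi * I * m / l)) = 1 := by
    rw [exp_eq_one_iff]
    refine ⟨j * m, ?_⟩
    have : (l : ℂ) ≠ 0 := by exact_mod_cast hl
    push_cast
    field_simp
  rw [seriesTerm, seriesTerm, h1, h2, h4, ofReal_mul_cpow (Real.exp_pos _) (div_ne_zero ht hb),
    Real.log_exp, h5, one_mul, mul_mul_mul_comm, h3, one_mul]

lemma seriesTerm_mul_transMat (κ : ℕ) (l : ℝ) (m : ℤ) (M : SL(2, ℝ)) (t : ℝ) (z : ℂ) :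
    seriesTerm κ l m (M * transMat t) z = seriesTerm κ l m M (z + t) := by
  simp only [seriesTerm, mul_entries, transMat_00, transMat_01, transMat_10, transMat_11]
  push_cast
  ring_nf

/-- The bound for imaginary powers with exponent `2πim/l`. -/
def powBound (l : ℝ) (m : ℤ) : ℝ := Real.exp (Real.pi * |2 * Real.pi * m / l|)

/-- The exponent is is' with s' = 2πm/l real and i the imaginary unit, up to that notation: the
modulus is governed by the argument of w alone, which is at most π in size. -/
lemma norm_cpow_le_powBound (l : ℝ) (m : ℤ) (w : ℂ) :
    ‖w ^ (2 * Real.pi * I * m / l : ℂ)‖ ≤ powBound l m := by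
  have hs : (2 * Real.pi * I * m / l : ℂ) = ((2 * Real.pi * m / l : ℝ) : ℂ) * I := by
    push_cast; ring
  refine (norm_cpow_le _ _).trans ?_
  rw [hs]
  simp only [mul_re, ofReal_re, I_re, mul_zero, ofReal_im, I_im, mul_one, sub_self, Real.rpow_zero,
    mul_im, add_zero]
  rw [one_div, ← Real.exp_neg, powBound, Real.exp_le_exp]
  refine (neg_le_abs _).trans ?_
  rw [abs_mul]
  exact mul_le_mul_of_nonneg_right (abs_arg_le_pi _) (abs_nonneg _)

lemma norm_seriesTerm_le {κ : ℕ} (hκ : 2 ≤ κ) (l : ℝ) (m : ℤ) {A δ : ℝ} (hδ : 0 < δ)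
    (M : SL(2, ℝ)) {z : ℂ} (hA : |z.re| ≤ A) (hz : δ ≤ z.im) :
    ‖seriesTerm κ l m M z‖ ≤ powBound l m / lowerConst A δ ^ κ * wt M := by
  set ε := lowerConst A δ
  have hε : 0 < ε := lowerConst_pos A hδ
  have h1 := le_norm_sq_linear hδ (M 0 0) (M 0 1) hA hz
  have h2 := le_norm_sq_linear hδ (M 1 0) (M 1 1) hA hz
  set x := ‖(M 0 0 * z + M 0 1 : ℂ) * (M 1 0 * z + M 1 1)‖ with hx
  have hx0 : 0 ≤ x := norm_nonneg _
  have hW := one_le_topSq_mul_botSq M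
  have hx2 : ε ^ 2 * (topSq M * botSq M) ≤ x ^ 2 := by
    rw [hx, norm_mul, mul_pow]
    calc ε ^ 2 * (topSq M * botSq M) = (ε * topSq M) * (ε * botSq M) := by ring
      _ ≤ _ := mul_le_mul h1 h2 (mul_nonneg hε.le (botSq_nonneg M)) (sq_nonneg _)
  -- Only the square of x is compared with the weight; the other κ - 2 factors are bounded below by
  -- ε, using `topSq M * botSq M` ≥ 1.
  have hx1 : ε ≤ x := by
    refine le_of_sq_le_sq ?_ hx0
    nlinarith [sq_nonneg ε]
  have hxκ : ε ^ κ * (topSq M * botSq M) ≤ x ^ κ := by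
    obtain ⟨j, rfl⟩ := Nat.exists_eq_add_of_le hκ
    rw [pow_add, pow_add]
    calc ε ^ 2 * ε ^ j * (topSq M * botSq M) = ε ^ 2 * (topSq M * botSq M) * ε ^ j := by ring
      _ ≤ x ^ 2 * x ^ j := by gcongr
  rw [seriesTerm, norm_div, norm_pow, ← hx, wt, div_mul_div_comm, mul_one]
  exact div_le_div₀ (Real.exp_pos _).le (norm_cpow_le_powBound l m _) (by positivity) hxκ

lemma differentiableAt_seriesTerm (κ : ℕ) (l : ℝ) (m : ℤ) (M : SL(2, ℝ)) {z : ℂ} (hz : 0 < z.im) :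
    DifferentiableAt ℂ (seriesTerm κ l m M) z := by
  have ht := top_ne_zero M hz
  have hb := bot_ne_zero M hz
  have hM : DifferentiableAt ℂ
      (fun z : ℂ => ((M 0 0 : ℂ) * z + M 0 1) / (M 1 0 * z + M 1 1)) z :=
    DifferentiableAt.div (by fun_prop) (by fun_prop) hb
  refine DifferentiableAt.div ?_ (by fun_prop) (pow_ne_zero κ (mul_ne_zero ht hb))
  -- The image point lies in the upper half-plane, away from the branch cut.
  exact hM.cpow (differentiableAt_const _) (Or.inr (im_moebius_pos M hz).ne')

/-! ### The integrals over horizontal lines -/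

lemma cpow_half {k : ℤ} {κ : ℕ} (hk : k = 2 * κ) (w : ℂ) : w ^ ((k : ℂ) / 2) = w ^ κ := by
  have : (k : ℂ) / 2 = (κ : ℂ) := by rw [hk]; push_cast; ring
  rw [this, cpow_natCast]

lemma integrable_hypParIntegrand {k : ℤ} {κ : ℕ} (hk : k = 2 * κ) (hκ : 1 ≤ κ) (l : ℝ) (m n : ℤ)
    (r : ℝ) {y : ℝ} (hy : 0 < y) :
    Integrable fun x : ℝ => hypParIntegrand k l m n r (x + y * I) := by
  set ε := lowerConst |r| y
  have hε : 0 < ε := lowerConst_pos |r| hy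
  refine Integrable.mono' (integrable_inv_one_add_sq.const_mul
    (powBound l m * Real.exp (2 * Real.pi * n * y) / ε ^ κ)) ?_
    (Filter.Eventually.of_forall fun x => ?_)
  · refine Measurable.aestronglyMeasurable ?_
    unfold hypParIntegrand
    fun_prop
  · have h1 := le_norm_sq_linear hy 1 x (z := -r + y * I) (A := |r|) (by simp) (by simp)
    have h2 := le_norm_sq_linear hy 1 x (z := r + y * I) (A := |r|) (by simp) (by simp)
    have e1 : ((1 : ℝ) : ℂ) * (-r + y * I) + x = x + y * I - r := by push_cast; ring
    have e2 : ((1 : ℝ) : ℂ) * (r + y * I) + x = x + y * I + r := by push_cast; ring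
    rw [e1, one_pow] at h1
    rw [e2, one_pow] at h2
    have hp : ε * (1 + x ^ 2) ≤ ‖(x + y * I - r : ℂ)‖ * ‖(x + y * I + r : ℂ)‖ := by
      refine le_of_sq_le_sq ?_ (by positivity)
      rw [mul_pow ‖(x + y * I - r : ℂ)‖, sq (ε * (1 + x ^ 2))]
      exact mul_le_mul h1 h2 (by positivity) (by positivity)
    have hpκ : ε ^ κ * (1 + x ^ 2) ≤ (‖(x + y * I - r : ℂ)‖ * ‖(x + y * I + r : ℂ)‖) ^ κ := by
      refine le_trans ?_ (pow_le_pow_left₀ (by positivity) hp κ)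
      rw [mul_pow]
      gcongr
      exact le_self_pow₀ (by nlinarith [sq_nonneg x]) (by omega)
    rw [hypParIntegrand, cpow_half hk, cpow_half hk, norm_div, norm_mul, norm_mul, norm_pow,
      norm_pow, ← mul_pow, norm_exp_neg_fourier, ← div_eq_mul_inv, div_div]
    refine div_le_div₀ (mul_pos (Real.exp_pos _) (Real.exp_pos _)).le ?_ (by positivity) hpκ
    exact mul_le_mul_of_nonneg_right (norm_cpow_le_powBound l m _) (Real.exp_pos _).le

/-- The zeros -b/a and -d/c have midpoint -β and differ by 1/(ac) = 2r. With u = z + β one gets az+b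
= a(u-r) and cz+d = c(u+r); |a/c| leaves the principal power since it is positive, and a/c has the
sign of r. -/
lemma seriesTerm_mul_exp_eq {k : ℤ} {κ : ℕ} (hk : k = 2 * κ) (l : ℝ) (m n : ℤ) (M : SL(2, ℝ))
    (hM : M 0 0 * M 1 0 ≠ 0) {z : ℂ} (hz : 0 < z.im) :
    seriesTerm κ l m M z * exp (-2 * Real.pi * I * n * z) =
      ((M 0 0 * M 1 0 : ℝ) : ℂ) ^ (-(k : ℂ) / 2) *
        hypParIntegrand k l m n (1 / (2 * (M 0 0 * M 1 0)))
          (z + (M 0 1 / (2 * M 0 0) + M 1 1 / (2 * M 1 0) : ℝ)) * kloostermanTerm l m n M := by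
  have ha : M 0 0 ≠ 0 := left_ne_zero_of_mul hM
  have hc : M 1 0 ≠ 0 := right_ne_zero_of_mul hM
  have ha' : (M 0 0 : ℂ) ≠ 0 := by exact_mod_cast ha
  have hc' : (M 1 0 : ℂ) ≠ 0 := by exact_mod_cast hc
  have hdet := det_entries M
  have hdet' : (M 0 0 * M 1 1 - M 0 1 * M 1 0 : ℂ) = 1 := by exact_mod_cast hdet
  have ht := top_ne_zero M hz
  have hb := bot_ne_zero M hz
  set β : ℝ := M 0 1 / (2 * M 0 0) + M 1 1 / (2 * M 1 0) with hβ
  set r : ℝ := 1 / (2 * (M 0 0 * M 1 0)) with hr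
  have h1 : (M 0 0 * z + M 0 1 : ℂ) = M 0 0 * (z + β - r) := by
    rw [hβ, hr]; push_cast; field_simp; linear_combination -hdet'
  have h2 : (M 1 0 * z + M 1 1 : ℂ) = M 1 0 * (z + β + r) := by
    rw [hβ, hr]; push_cast; field_simp; linear_combination hdet'
  have hu1 : (z + β - r : ℂ) ≠ 0 := fun h => ht (by rw [h1, h, mul_zero])
  have hu2 : (z + β + r : ℂ) ≠ 0 := fun h => hb (by rw [h2, h, mul_zero])
  have hr0 : r ≠ 0 := by rw [hr]; positivity
  have hsign : (|M 0 0 / M 1 0| : ℝ) * Real.sign r = M 0 0 / M 1 0 := by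
    rcases lt_or_gt_of_ne hM with h | h
    · have hrneg : r < 0 := by rw [hr]; exact one_div_neg.2 (by linarith)
      have : M 0 0 / M 1 0 < 0 := by
        rw [div_eq_mul_inv]
        rcases mul_neg_iff.1 h with h | h
        · exact mul_neg_of_pos_of_neg h.1 (inv_lt_zero.2 h.2)
        · exact mul_neg_of_neg_of_pos h.1 (inv_pos.2 h.2)
      rw [Real.sign_of_neg hrneg, abs_of_neg this]; ring
    · have hrpos : 0 < r := by rw [hr]; positivity
      have : 0 < M 0 0 / M 1 0 := by
        rw [div_eq_mul_inv]
        rcases mul_pos_iff.1 h with h | h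
        · exact mul_pos h.1 (inv_pos.2 h.2)
        · exact mul_pos_of_neg_of_neg h.1 (inv_lt_zero.2 h.2)
      rw [Real.sign_of_pos hrpos, abs_of_pos this]; ring
  have hsign' : ((|M 0 0 / M 1 0| : ℝ) : ℂ) * (Real.sign r : ℝ) = M 0 0 / M 1 0 := by
    exact_mod_cast hsign
  have hsign0 : ((Real.sign r : ℝ) : ℂ) ≠ 0 := by
    exact_mod_cast (Real.sign_eq_zero_iff.not.2 hr0)
  have hw : (M 0 0 * z + M 0 1 : ℂ) / (M 1 0 * z + M 1 1) =
      ((|M 0 0 / M 1 0| : ℝ) : ℂ) * ((Real.sign r : ℝ) * ((z + β - r) / (z + β + r))) := by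
    rw [← mul_assoc, hsign', h1, h2, mul_div_mul_comm]
  have hpow : ((M 0 0 * M 1 0 : ℝ) : ℂ) ^ (-(k : ℂ) / 2) = (((M 0 0 * M 1 0 : ℝ) : ℂ) ^ κ)⁻¹ := by
    rw [neg_div, cpow_neg, cpow_half hk]
  rw [seriesTerm, hw, ofReal_mul_cpow (abs_pos.2 (div_ne_zero ha hc))
    (mul_ne_zero hsign0 (div_ne_zero hu1 hu2)), hpow, hypParIntegrand, cpow_half hk, cpow_half hk,
    kloostermanTerm, h1, h2, ← hβ]
  have hexp : exp (Real.log |M 0 0 / M 1 0| * (2 * Real.pi * I * m / l)) *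
      exp (-2 * Real.pi * I * n * z) = exp (-2 * Real.pi * I * n * (z + β)) *
      exp (2 * Real.pi * I * ((m / l * Real.log |M 0 0 / M 1 0| + n * β : ℝ) : ℂ)) := by
    rw [← exp_add, ← exp_add]
    congr 1
    push_cast
    ring
  generalize ((Real.sign r : ℂ) * ((z + β - r) / (z + β + r))) ^ (2 * Real.pi * I * m / l) = W
  have e3 : (M 0 0 * (z + β - r) * (M 1 0 * (z + β + r)) : ℂ) ^ κ =
      ((M 0 0 * M 1 0 : ℝ) : ℂ) ^ κ * ((z + β - r) ^ κ * (z + β + r) ^ κ) := by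
    rw [← mul_pow, ← mul_pow]; congr 1; push_cast; ring
  rw [e3]
  calc _ = exp (Real.log |M 0 0 / M 1 0| * (2 * Real.pi * I * m / l)) *
      exp (-2 * Real.pi * I * n * z) * W /
        (((M 0 0 * M 1 0 : ℝ) : ℂ) ^ κ * ((z + β - r) ^ κ * (z + β + r) ^ κ)) := by ring
    _ = _ := by rw [hexp, div_eq_mul_inv, mul_inv]; ring

lemma integrable_seriesTerm_line {κ : ℕ} (hκ : 1 ≤ κ) (l : ℝ) (m n : ℤ)
    (M : SL(2, ℝ)) (hM : M 0 0 * M 1 0 ≠ 0) {y : ℝ} (hy : 0 < y) :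
    Integrable (fun x : ℝ =>
      seriesTerm κ l m M (x + y * I) * exp (-2 * Real.pi * I * n * (x + y * I))) := by
  have hk : (2 * κ : ℤ) = 2 * κ := rfl
  have h := (((integrable_hypParIntegrand hk hκ l m n (1 / (2 * (M 0 0 * M 1 0))) hy).comp_add_right
    (M 0 1 / (2 * M 0 0) + M 1 1 / (2 * M 1 0))).const_mul
    (((M 0 0 * M 1 0 : ℝ) : ℂ) ^ (-((2 * κ : ℤ) : ℂ) / 2))).mul_const (kloostermanTerm l m n M)
  refine h.congr (Filter.Eventually.of_forall fun x => ?_)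
  simp only
  rw [seriesTerm_mul_exp_eq hk l m n M hM (by simpa using hy)]
  congr 3
  push_cast
  ring

lemma integral_seriesTerm_line {k : ℤ} {κ : ℕ} (hk : k = 2 * κ) (l : ℝ) (m n : ℤ)
    (M : SL(2, ℝ)) (hM : M 0 0 * M 1 0 ≠ 0) {y : ℝ} (hy : 0 < y) :
    ∫ x : ℝ, seriesTerm κ l m M (x + y * I) * exp (-2 * Real.pi * I * n * (x + y * I)) =
      ((M 0 0 * M 1 0 : ℝ) : ℂ) ^ (-(k : ℂ) / 2) *
        hypParIntegral k l m n (1 / (2 * (M 0 0 * M 1 0))) y * kloostermanTerm l m n M := by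
  rw [hypParIntegral, ← integral_add_right_eq_self
      (fun x : ℝ => hypParIntegrand k l m n (1 / (2 * (M 0 0 * M 1 0))) (x + y * I))
      (M 0 1 / (2 * M 0 0) + M 1 1 / (2 * M 1 0)),
    ← integral_const_mul, ← integral_mul_const]
  congr 1
  funext x
  rw [seriesTerm_mul_exp_eq hk l m n M hM (by simpa using hy)]
  congr 3
  push_cast
  ring

section

variable {Γ : Subgroup SL(2, ℝ)} {η : OnePoint ℝ × OnePoint ℝ} {ση : SL(2, ℝ)}
  {𝔞 : OnePoint ℝ} {σa : SL(2, ℝ)}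

/-! ### The Poincaré series at the cusp -/

lemma countable_of_discrete (hd : DiscreteTopology Γ) : Countable Γ := by
  have : SecondCountableTopology (Matrix (Fin 2) (Fin 2) ℝ) :=
    inferInstanceAs (SecondCountableTopology (Fin 2 → Fin 2 → ℝ))
  have : SecondCountableTopology SL(2, ℝ) :=
    TopologicalSpace.Subtype.secondCountableTopology {A : Matrix (Fin 2) (Fin 2) ℝ | A.det = 1}
  exact TopologicalSpace.separableSpace_iff_countable.1 inferInstance

lemma seriesTerm_mul_of_mem (hd : DiscreteTopology Γ) (hη : IsHypPair Γ η)
    (hση : IsHypScaling η ση) (σ : SL(2, ℝ)) (κ : ℕ) (m : ℤ) {z : ℂ} (hz : 0 < z.im) {h : Γ}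
    (hh : h ∈ pairFixer Γ η) (γ : Γ) :
    seriesTerm κ (hypLength Γ η ση) m (ση⁻¹ * (h * γ : Γ) * σ) z =
      seriesTerm κ (hypLength Γ η ση) m (ση⁻¹ * γ * σ) z := by
  rw [conj_mul]
  have hl := (hypLength_pos hd hη hση).ne'
  obtain ⟨j, hj | hj⟩ := exists_int_of_mem hd hη hση hh <;> rw [hj]
  · rw [seriesTerm_dilMat_mul κ hl m j _ hz]
  · rw [neg_mul, seriesTerm_neg, seriesTerm_dilMat_mul κ hl m j _ hz]

theorem summable_poincareTerm (hd : DiscreteTopology Γ) (hη : IsHypPair Γ η)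
    (hση : IsHypScaling η ση) {k : ℤ} {κ : ℕ} (hk : k = 2 * κ) (hκ : 2 ≤ κ) (m : ℤ) (z : ℍ) :
    Summable fun q : HypCosets Γ η =>
      ‖poincareTerm k (hypLength Γ η ση) m ση (q.out : Γ) z‖ := by
  refine Summable.of_nonneg_of_le (fun q => norm_nonneg _) (fun q => ?_)
    ((summable_wt hd hη hση 1).mul_left (powBound (hypLength Γ η ση) m /
      lowerConst |z.re| z.im ^ κ))
  rw [poincareTerm, slash_eq_seriesTerm hk, mul_one]
  exact norm_seriesTerm_le hκ _ m z.im_pos _ le_rfl le_rfl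

variable (Γ η ση 𝔞 σa) in
/-- The Poincaré series transported to the cusp `𝔞`, as a sum over double cosets and
translations. -/
def cuspSeries (κ : ℕ) (m : ℤ) (z : ℂ) : ℂ :=
  ∑' p : HypParDoubleCosets Γ η 𝔞 × ℤ,
    seriesTerm κ (hypLength Γ η ση) m (ση⁻¹ * (Quotient.out p.1 : Γ) * σa * transMat p.2) z

lemma slash_hypPoincare (hd : DiscreteTopology Γ) (hη : IsHypPair Γ η)
    (hση : IsHypScaling η ση) (hσa : IsCuspScaling Γ 𝔞 σa) {k : ℤ} {κ : ℕ} (hk : k = 2 * κ)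
    (m : ℤ) (z : ℍ) :
    slash k (hypPoincare Γ k η ση m) σa z = cuspSeries Γ η ση 𝔞 σa κ m z := by
  obtain ⟨τ⟩ := exists_transSection hσa
  have h1 (q : HypCosets Γ η) : ((σa 1 0 : ℂ) * z + σa 1 1) ^ (-k) *
      poincareTerm k (hypLength Γ η ση) m ση (q.out : Γ) (σa • z) =
      seriesTerm κ (hypLength Γ η ση) m (ση⁻¹ * (q.out : Γ) * σa) z := by
    rw [← slash_apply, ← slash_eq_seriesTerm hk, poincareTerm, slash, slash, slash, map_mul,
      map_mul, SlashAction.slash_mul _ _ ((Matrix.SpecialLinearGroup.toGL) σa)]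
    simp only [map_mul]
  rw [slash_apply, hypPoincare, ← tsum_mul_left]
  simp only [h1]
  rw [← (cosetEquiv hd hη hση hσa τ).tsum_eq, cuspSeries]
  refine tsum_congr fun p => ?_
  exact apply_cosetEquiv_out hd hη hση hσa τ
    (fun M => seriesTerm κ (hypLength Γ η ση) m M z)
    (fun M => by simp only [seriesTerm_neg])
    (fun h hh γ => seriesTerm_mul_of_mem hd hη hση σa κ m z.im_pos hh γ) p.1 p.2

/-- Locally uniform convergence: on a neighbourhood with bounded real part and height bounded below
the terms are dominated by the weights. -/
lemma differentiableOn_cuspSeries (hd : DiscreteTopology Γ) (hη : IsHypPair Γ η)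
    (hση : IsHypScaling η ση) (hσa : IsCuspScaling Γ 𝔞 σa) {κ : ℕ} (hκ : 2 ≤ κ) (m : ℤ) :
    DifferentiableOn ℂ (cuspSeries Γ η ση 𝔞 σa κ m) {z | 0 < z.im} := by
  intro z₀ hz₀
  have hz₀' : 0 < z₀.im := hz₀
  set U : Set ℂ := {z | |z.re| < |z₀.re| + 1} ∩ {z | z₀.im / 2 < z.im}
  have hU : IsOpen U := (isOpen_lt (continuous_re.abs) continuous_const).inter
    (isOpen_lt continuous_const continuous_im)
  have hmem : z₀ ∈ U := ⟨by simp, by simp only [Set.mem_ofPred_eq]; linarith⟩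
  have h := differentiableOn_tsum_of_summable_norm
    (F := fun (p : HypParDoubleCosets Γ η 𝔞 × ℤ) (z : ℂ) => seriesTerm κ (hypLength Γ η ση) m
      (ση⁻¹ * (Quotient.out p.1 : Γ) * σa * transMat p.2) z)
    ((summable_wt_doubleCosets hd hη hση hσa).mul_left (powBound (hypLength Γ η ση) m /
      lowerConst (|z₀.re| + 1) (z₀.im / 2) ^ κ))
    (fun p z hz => (differentiableAt_seriesTerm κ _ m _
      (lt_trans (by positivity) hz.2)).differentiableWithinAt) hU
    (fun p z hz => norm_seriesTerm_le hκ _ m (by positivity) _ (le_of_lt hz.1) (le_of_lt hz.2))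
  exact ((h z₀ hmem).differentiableAt (hU.mem_nhds hmem)).differentiableWithinAt

lemma cuspSeries_add_one (κ : ℕ) (m : ℤ) (z : ℂ) :
    cuspSeries Γ η ση 𝔞 σa κ m (z + 1) = cuspSeries Γ η ση 𝔞 σa κ m z := by
  rw [cuspSeries, cuspSeries, ← ((Equiv.refl _).prodCongr (Equiv.addRight (1 : ℤ))).tsum_eq (fun
    p : HypParDoubleCosets Γ η 𝔞 × ℤ => seriesTerm κ (hypLength Γ η ση) m
      (ση⁻¹ * (Quotient.out p.1 : Γ) * σa * transMat p.2) z)]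
  refine tsum_congr fun p => ?_
  simp only [Equiv.prodCongr_apply, Prod.map_fst, Prod.map_snd, Equiv.refl_apply,
    Equiv.coe_addRight, seriesTerm_mul_transMat]
  congr 1
  push_cast
  ring

lemma hasSum_lineCoeff_cuspSeries (hd : DiscreteTopology Γ) (hη : IsHypPair Γ η)
    (hση : IsHypScaling η ση) (hσa : IsCuspScaling Γ 𝔞 σa) {κ : ℕ} (hκ : 2 ≤ κ) (m n : ℤ)
    {y : ℝ} (hy : 0 < y) :
    HasSum (fun p : HypParDoubleCosets Γ η 𝔞 × ℤ => lineCoeff (seriesTerm κ (hypLength Γ η ση) m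
      (ση⁻¹ * (Quotient.out p.1 : Γ) * σa * transMat p.2)) n y)
      (lineCoeff (cuspSeries Γ η ση 𝔞 σa κ m) n y) := by
  have := countable_of_discrete hd
  have : Countable (HypParDoubleCosets Γ η 𝔞) := Quotient.countable
  have hw := summable_wt_doubleCosets hd hη hση hσa
  have hbound (p : HypParDoubleCosets Γ η 𝔞 × ℤ) (x : ℝ) (hx : x ∈ Set.uIoc (0 : ℝ) 1) :
      ‖seriesTerm κ (hypLength Γ η ση) m (ση⁻¹ * (Quotient.out p.1 : Γ) * σa * transMat p.2)
        (x + y * I)‖ ≤ powBound (hypLength Γ η ση) m / lowerConst 1 y ^ κ *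
          wt (ση⁻¹ * (Quotient.out p.1 : Γ) * σa * transMat p.2) := by
    rw [Set.uIoc_of_le zero_le_one] at hx
    refine norm_seriesTerm_le hκ _ m hy _ ?_ (by simp)
    simpa [abs_of_pos hx.1] using hx.2
  refine intervalIntegral.hasSum_integral_of_dominated_convergence
    (fun p _ => powBound (hypLength Γ η ση) m / lowerConst 1 y ^ κ *
      wt (ση⁻¹ * (Quotient.out p.1 : Γ) * σa * transMat p.2) * Real.exp (2 * Real.pi * n * y))
    (fun p => ?_) (fun p => Filter.Eventually.of_forall fun x hx => ?_)
    (Filter.Eventually.of_forall fun x _ => (hw.mul_left _).mul_right _) (by simp)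
    (Filter.Eventually.of_forall fun x hx => ?_)
  · refine Continuous.aestronglyMeasurable (Continuous.mul ?_ (by fun_prop))
    exact differentiableOn_continuous_line
      (fun z hz => (differentiableAt_seriesTerm κ _ m _ hz).differentiableWithinAt) hy
  · rw [norm_mul, norm_exp_neg_fourier]
    exact mul_le_mul_of_nonneg_right (hbound p x hx) (Real.exp_pos _).le
  · refine HasSum.mul_right _ ?_
    exact (Summable.of_norm_bounded (hw.mul_left _) (fun p => hbound p x hx)).hasSum

/-- Unfolding: for a fixed double coset the translates contribute the integrals over [t, t+1], which
together make up the whole line. -/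
lemma hasSum_integral_seriesTerm (hd : DiscreteTopology Γ) (hη : IsHypPair Γ η)
    (hση : IsHypScaling η ση) (hσa : IsCuspScaling Γ 𝔞 σa) {κ : ℕ} (hκ : 2 ≤ κ) (m n : ℤ)
    {y : ℝ} (hy : 0 < y) :
    HasSum (fun Q : HypParDoubleCosets Γ η 𝔞 => ∫ x : ℝ, seriesTerm κ (hypLength Γ η ση) m
      (ση⁻¹ * (Quotient.out Q : Γ) * σa) (x + y * I) * exp (-2 * Real.pi * I * n * (x + y * I)))
      (lineCoeff (cuspSeries Γ η ση 𝔞 σa κ m) n y) := by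
  refine (hasSum_lineCoeff_cuspSeries hd hη hση hσa hκ m n hy).prod_fiberwise fun Q => ?_
  have h := (integrable_seriesTerm_line (one_le_two.trans hκ) (hypLength Γ η ση) m n
    (ση⁻¹ * (Quotient.out Q : Γ) * σa)
    (prod_ne_zero hd hη hση hσa (Quotient.out Q)) hy).hasSum_intervalIntegral_comp_add_int
  have hline (t : ℤ) : lineCoeff (seriesTerm κ (hypLength Γ η ση) m
      (ση⁻¹ * (Quotient.out Q : Γ) * σa * transMat t)) n y =
      ∫ x in (0 : ℝ)..1, seriesTerm κ (hypLength Γ η ση) m (ση⁻¹ * (Quotient.out Q : Γ) * σa)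
        ((x + t : ℝ) + y * I) * exp (-2 * Real.pi * I * n * ((x + t : ℝ) + y * I)) := by
    refine intervalIntegral.integral_congr fun x _ => ?_
    have e : ((x + t : ℝ) : ℂ) + y * I = x + y * I + t := by push_cast; ring
    have e1 : exp (-2 * Real.pi * I * n * t) = 1 := by
      rw [exp_eq_one_iff]
      exact ⟨-n * t, by push_cast; ring⟩
    simp only [e, seriesTerm_mul_transMat, ofReal_intCast]
    rw [mul_add (-2 * Real.pi * I * n) _ (t : ℂ), exp_add _ (-2 * Real.pi * I * n * (t : ℂ)), e1,
      mul_one]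
  simp only [hline]
  exact h

theorem hasSum_coeffTerm (hd : DiscreteTopology Γ) (hη : IsHypPair Γ η)
    (hση : IsHypScaling η ση) (hσa : IsCuspScaling Γ 𝔞 σa) {k : ℤ} {κ : ℕ} (hk : k = 2 * κ)
    (hκ : 2 ≤ κ) (m n : ℤ) {y : ℝ} (hy : 0 < y) :
    HasSum (fun C : modSet Γ ση σa => coeffTerm Γ k η ση 𝔞 σa m n y C)
      (lineCoeff (cuspSeries Γ η ση 𝔞 σa κ m) n y) := by
  let prod : HypParDoubleCosets Γ η 𝔞 → modSet Γ ση σa := fun Q =>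
    ⟨(ση⁻¹ * (Quotient.out Q : Γ) * σa) 0 0 * (ση⁻¹ * (Quotient.out Q : Γ) * σa) 1 0,
      (Quotient.out Q : Γ), (Quotient.out Q : Γ).2, rfl⟩
  -- Partition the double cosets by the value of ac; on each finite fibre the integral is a common
  -- factor and the phases add up to the Kloosterman sum.
  have h := (Equiv.sigmaFiberEquiv prod).hasSum_iff.2
    (hasSum_integral_seriesTerm hd hη hση hσa hκ m n hy)
  refine h.sigma fun C => ?_
  have hfin := finite_doubleCosetsAt hd hη hση hσa (C : ℝ)
  let e : doubleCosetsAt Γ η ση 𝔞 σa C ≃ {Q // prod Q = C} :=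
    Equiv.subtypeEquivRight fun Q => (Subtype.ext_iff (a1 := prod Q) (a2 := C)).symm
  rw [← e.hasSum_iff]
  have : Finite (doubleCosetsAt Γ η ση 𝔞 σa C) := hfin
  have := Fintype.ofFinite (doubleCosetsAt Γ η ση 𝔞 σa C)
  have hk' : coeffTerm Γ k η ση 𝔞 σa m n y C = ∑ Q : doubleCosetsAt Γ η ση 𝔞 σa C,
      (C : ℂ) ^ (-(k : ℂ) / 2) * hypParIntegral k (hypLength Γ η ση) m n (1 / (2 * C)) y *
        kloostermanTerm (hypLength Γ η ση) m n (ση⁻¹ * (Quotient.out Q.1 : Γ) * σa) := by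
    rw [← Finset.mul_sum, coeffTerm, kloosterman, ← finsum_set_coe_eq_finsum_mem,
      finsum_eq_sum_of_fintype]
  rw [hk']
  convert hasSum_fintype _ using 1
  refine Finset.sum_congr rfl fun ⟨Q, hQ⟩ _ => ?_
  have hQ' : (ση⁻¹ * (Quotient.out Q : Γ) * σa) 0 0 * (ση⁻¹ * (Quotient.out Q : Γ) * σa) 1 0 =
    (C : ℝ) := hQ
  have := integral_seriesTerm_line hk (hypLength Γ η ση) m n (ση⁻¹ * (Quotient.out Q : Γ) * σa)
    (prod_ne_zero hd hη hση hσa (Quotient.out Q)) hy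
  rw [hQ'] at this
  exact this.symm

end

end HypPoincare

end

/-! ### Assembly of the Fourier expansion -/

theorem theorem4p8
    (Γ : Subgroup SL(2, ℝ)) (hΓ : HypPoincare.IsFuchsianFirstKind Γ)
    (k : ℤ) (hk_even : Even k) (hk : 2 < k)
    (η : OnePoint ℝ × OnePoint ℝ) (hη : HypPoincare.IsHypPair Γ η)
    (ση : SL(2, ℝ)) (hση : HypPoincare.IsHypScaling η ση)
    (𝔞 : OnePoint ℝ)
    (h𝔞 : IsCusp 𝔞 (Γ.map (Matrix.SpecialLinearGroup.toGL : SL(2, ℝ) →* GL (Fin 2) ℝ)))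
    (σa : SL(2, ℝ)) (hσa : HypPoincare.IsCuspScaling Γ 𝔞 σa)
    (m : ℤ) (y : ℝ) (hy : 0 < y) :
    -- the Poincaré series converges absolutely
    (∀ z : ℍ, Summable fun q : HypPoincare.HypCosets Γ η =>
      ‖HypPoincare.poincareTerm k (HypPoincare.hypLength Γ η ση) m ση (q.out : Γ) z‖) ∧
    -- `C` is never zero, and the Kloosterman sums and the integrals are well defined
    (∀ C ∈ HypPoincare.modSet Γ ση σa, C ≠ 0 ∧
      (HypPoincare.doubleCosetsAt Γ η ση 𝔞 σa C).Finite ∧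
      ∀ n : ℤ, MeasureTheory.Integrable fun x : ℝ =>
        HypPoincare.hypParIntegrand k (HypPoincare.hypLength Γ η ση) m n (1 / (2 * C))
          (x + y * Complex.I)) ∧
    -- the sum over `C` converges absolutely
    (∀ n : ℤ, Summable fun C : HypPoincare.modSet Γ ση σa =>
      ‖HypPoincare.coeffTerm Γ k η ση 𝔞 σa m n y C‖) ∧
    -- the parabolic Fourier coefficients at `𝔞` exist and are given by the sum over `C`
    (∀ c : ℤ → ℂ,
      HypPoincare.IsParCoeffs k σa (HypPoincare.hypPoincare Γ k η ση m) c ↔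
        ∀ n : ℤ, c n = ∑' C : HypPoincare.modSet Γ ση σa,
          HypPoincare.coeffTerm Γ k η ση 𝔞 σa m n y C) := by

  have hd := hΓ.discrete
  obtain ⟨j, hj⟩ := hk_even
  obtain ⟨κ, rfl⟩ := Int.eq_ofNat_of_zero_le (show 0 ≤ j by omega)
  have hk2 : k = 2 * κ := by omega
  have hκ : 2 ≤ κ := by omega
  have hsum (n : ℤ) := HypPoincare.hasSum_coeffTerm hd hη hση hσa hk2 hκ m n hy
  refine ⟨fun z => HypPoincare.summable_poincareTerm hd hη hση hk2 hκ m z, ?_,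
    -- For complex families unconditional summability is absolute.
    fun n => (hsum n).summable.norm, fun c => ?_⟩
  · rintro C ⟨γ, hγ, rfl⟩
    exact ⟨HypPoincare.prod_ne_zero hd hη hση hσa ⟨γ, hγ⟩,
      HypPoincare.finite_doubleCosetsAt hd hη hση hσa _,
      fun n => HypPoincare.integrable_hypParIntegrand hk2 (by omega) _ m n _ hy⟩
  · simp only [HypPoincare.IsParCoeffs, HypPoincare.slash_hypPoincare hd hη hση hσa hk2,
      (hsum _).tsum_eq]
    exact HypPoincare.hasSum_fourier_iff
      (HypPoincare.differentiableOn_cuspSeries hd hη hση hσa hκ m)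
      (fun z _ => HypPoincare.cuspSeries_add_one κ m z) hy c
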